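/- Let $k$ be a field in which $2$ and $3$ are invertible and which contains an element $i$ with $i^2=-1$. Let $B=k[t^2,t^3]\subset k[t]$, and let $\sigma=(\sigma_{rs})\in \mathrm M_3(\mathrm{End}_k(B))$ be the matrix of linear maps such that $\sigma_{rs}(b)$ is the $(r,s)$-entry of $b(T)$, where $$T=\begin{pmatrix} t & t-i & -\tfrac13t^{-1}-\tfrac12t\\ 0&-t&t+i\\ 0&0&t\end{pmatrix}\in \mathrm M_3(k[t,t^{-1}]).$$ There is a unique family of invertible matrices $\sigma_d\in\mathrm{GL}_3(\mathrm{End}_k(B))$, $d\in\mathbb Z$, with $\sigma_0=\sigma$ and $\sigma_{d+1}=(\sigma_d^{-1})^T$. Let $\mathcal F$ be the Hopf algebra with algebra generators $s_{d,ij}$ ($d\in\mathbb Z$, $1\le i,j\le 3$), relations $\sum_r s_{d,ir}s_{d+1,jr}=\delta_{ij}=\sum_r s_{d+1,ri}s_{d,rj}$, and $\Delta(s_{d,ij})=\sum_r s_{d,ir}\otimes s_{d,rj}$, $\varepsilon(s_{d,ij})=\delta_{ij}$, $S(s_{d,ij})=s_{d+1,ji}$. It acts on $B$ by $s_{d,ij}\mapsto\sigma_{d,ij}$.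 Let $H_\sigma$ be the quotient of $\mathcal F$ by the sum of all Hopf ideals contained in the kernel of this action. Let $H_\sigma^\circ$ be its Hopf dual (the functionals on $H_\sigma$ that vanish on a two-sided ideal of finite codimension), and let $A_\sigma\subseteq H_\sigma^\circ$ be the Hopf subalgebra generated by the matrix coefficients $X\mapsto f(X\triangleright b)$, $b\in B$, $f\in B^*$. Then $F_3=\mathrm{span}_k\{e_1,e_2,e_3\}$, with $e_1=1$, $e_2=t^2$, $e_3=t^3$, is an $H_\sigma$-submodule of $B$, its matrix coefficients $a_{rs}$, defined by $X\triangleright e_s=\sum_r a_{rs}(X)\,e_r$, lie in $A_\sigma$, and the following hold. 1. The algebra morphism $\pi\colon k\langle\gamma,\varphi,\psi\rangle\to A_\sigma$ with $\pi(\gamma)=a_{13}$, $\pi(\varphi)=a_{23}$, $\pi(\psi)=a_{33}$ is surjective, and its kernel contains the two-sided ideal generated by $$\psi^2-1,\quad \gamma\psi+\psi\gamma,\quad \varphi\psi+\psi\varphi,\quad 27\gamma^2-\varphi^6,\quad 3(\gamma\varphi+\varphi\gamma)-\varphi^4 .$$ If $k$ has characteristic $0$, then the kernel is equal to this ideal.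 2. Writing $\gamma,\varphi,\psi$ also for their images in $A_\sigma$, the coproduct, counit and antipode of $A_\sigma$ are given by $$\Delta(\psi)=\psi\otimes\psi,\quad \Delta(\varphi)=1\otimes\varphi+\varphi\otimes\psi,\quad \Delta(\gamma)=1\otimes\gamma+\tfrac13\varphi^2\otimes\varphi+\gamma\otimes\psi,$$ $$\varepsilon(\psi)=1,\quad \varepsilon(\gamma)=\varepsilon(\varphi)=0,$$ $$S(\psi)=\psi,\quad S(\varphi)=-\varphi\psi,\quad S(\gamma)=\left(\tfrac13\varphi^3-\gamma\right)\psi .$$ -/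

import Mathlib

open scoped TensorProduct Matrix LaurentPolynomial Polynomial
open Coalgebra HopfAlgebra

namespace QuantumCusp

section StrongInvertibility

/-- `s` is a sequence of matrices with `s 0 = σ`, all invertible, with `s (d+1)` the transpose of
the inverse of `s d`. -/
def IsContragredientSeq {P : Type*} [Ring P] {n : ℕ} (σ : Matrix (Fin n) (Fin n) P)
    (s : ℤ → Matrix (Fin n) (Fin n) P) : Prop :=
  s 0 = σ ∧ ∀ d, s d * (s (d + 1))ᵀ = 1 ∧ (s (d + 1))ᵀ * s d = 1

/-- Strongly invertible matrices over a (noncommutative) ring. -/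
def StronglyInvertible {P : Type*} [Ring P] {n : ℕ} (σ : Matrix (Fin n) (Fin n) P) : Prop :=
  ∃ s : ℤ → Matrix (Fin n) (Fin n) P, IsContragredientSeq σ s

/-- A quantum automorphism of the `k`-algebra `B`: a strongly invertible matrix of `k`-linear
endomorphisms such that `b ↦ (σ i j b)` is a unital and multiplicative map to matrices. -/
structure IsQuantumAut {k B : Type*} [CommRing k] [Ring B] [Algebra k B] {n : ℕ}
    (σ : Matrix (Fin n) (Fin n) (Module.End k B)) : Prop where
  stronglyInvertible : StronglyInvertible σ
  map_one : ∀ i j, σ i j 1 = (1 : Matrix (Fin n) (Fin n) B) i j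
  map_mul : ∀ i j a b, σ i j (a * b) = ∑ l, σ i l a * σ l j b

/-- The contragredient sequence of a strongly invertible matrix (it is unique). -/
noncomputable def StronglyInvertible.seq {P : Type*} [Ring P] {n : ℕ}
    {σ : Matrix (Fin n) (Fin n) P} (h : StronglyInvertible σ) : ℤ → Matrix (Fin n) (Fin n) P :=
  h.choose

theorem StronglyInvertible.seq_spec {P : Type*} [Ring P] {n : ℕ}
    {σ : Matrix (Fin n) (Fin n) P} (h : StronglyInvertible σ) : IsContragredientSeq σ h.seq :=
  h.choose_spec

theorem IsContragredientSeq.unique {P : Type*} [Ring P] {n : ℕ} {σ : Matrix (Fin n) (Fin n) P}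
    {s s' : ℤ → Matrix (Fin n) (Fin n) P} (h : IsContragredientSeq σ s)
    (h' : IsContragredientSeq σ s') : s = s' := by
  funext d
  induction d using Int.induction_on with
  | zero => rw [h.1, h'.1]
  | succ m ih =>
    have h1 := (h.2 m).2
    have h2 := (h'.2 m).1
    rw [← ih] at h2
    exact Matrix.transpose_injective (left_inv_eq_right_inv h1 h2)
  | pred m ih =>
    have h1 := (h.2 (-m - 1)).1
    have h2 := (h'.2 (-m - 1)).2
    rw [sub_add_cancel] at h1 h2
    rw [← ih] at h2
    exact left_inv_eq_right_inv h1 h2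

/-- An upper triangular `3 × 3` matrix with diagonal `1, K, 1`, where `K * K = 1`. -/
def upperTri {P : Type*} [Ring P] (K : P) (u : P × P × P) : Matrix (Fin 3) (Fin 3) P :=
  !![1, u.1, u.2.2; 0, K, u.2.1; 0, 0, 1]

/-- The transpose of the inverse of `upperTri K u`. -/
def upperTriHat {P : Type*} [Ring P] (K : P) (u : P × P × P) : Matrix (Fin 3) (Fin 3) P :=
  !![1, 0, 0; -(u.1 * K), K, 0; u.1 * K * u.2.1 - u.2.2, -(K * u.2.1), 1]

/-- Applying the contragredient twice to `upperTri K u` gives `upperTri K (upperTriStep u)`. -/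
def upperTriStep {P : Type*} [Ring P] (K : P) (hK : K * K = 1) : Equiv.Perm (P × P × P) where
  toFun u := (K * u.1 * K, K * u.2.1 * K,
    u.2.2 - u.1 * K * u.2.1 + K * u.2.1 * K * u.1 * K)
  invFun u := (K * u.1 * K, K * u.2.1 * K,
    u.2.2 + K * u.1 * K * u.2.1 * K - u.2.1 * K * u.1)
  left_inv u := by
    obtain ⟨E, F, Z⟩ := u
    have h : ∀ x : P, K * (K * x) = x := fun x => by rw [← mul_assoc, hK, one_mul]
    simp only [mul_assoc, hK, h, mul_one, Prod.mk.injEq, true_and]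
    abel
  right_inv u := by
    obtain ⟨E, F, Z⟩ := u
    have h : ∀ x : P, K * (K * x) = x := fun x => by rw [← mul_assoc, hK, one_mul]
    simp only [mul_assoc, hK, h, mul_one, Prod.mk.injEq, true_and]
    abel

theorem upperTri_stronglyInvertible {P : Type*} [Ring P] (K : P) (hK : K * K = 1)
    (u : P × P × P) : StronglyInvertible (upperTri K u) := by
  classical
  have h : ∀ x : P, K * (K * x) = x := fun x => by rw [← mul_assoc, hK, one_mul]
  let f : ℤ → P × P × P := fun m => (upperTriStep K hK ^ m) u
  have hf : ∀ m, f (m + 1) = upperTriStep K hK (f m) := fun m => by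
    simp only [f]; rw [add_comm, zpow_add, zpow_one, Equiv.Perm.mul_apply]
  refine ⟨fun d => if d % 2 = 0 then upperTri K (f (d / 2)) else upperTriHat K (f (d / 2)),
    by simp [f], fun d => ?_⟩
  rcases Int.emod_two_eq_zero_or_one d with hd | hd
  · have h1 : (d + 1) % 2 = 1 := by omega
    have h2 : (d + 1) / 2 = d / 2 := by omega
    simp only [hd, h1, h2, if_true, one_ne_zero, if_false]
    generalize f (d / 2) = v
    obtain ⟨E, F, Z⟩ := v
    constructor
    · ext i j
      fin_cases i <;> fin_cases j
      all_goals simp [upperTri, upperTriHat, Matrix.mul_apply, Fin.sum_univ_three, mul_assoc, hK, h]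
      all_goals abel
    · ext i j
      fin_cases i <;> fin_cases j
      all_goals simp [upperTri, upperTriHat, Matrix.mul_apply, Fin.sum_univ_three, mul_assoc, hK]
      all_goals abel
  · have h1 : (d + 1) % 2 = 0 := by omega
    have h2 : (d + 1) / 2 = d / 2 + 1 := by omega
    simp only [hd, h1, h2, if_true, one_ne_zero, if_false, hf]
    generalize f (d / 2) = v
    obtain ⟨E, F, Z⟩ := v
    constructor
    · ext i j
      fin_cases i <;> fin_cases j <;>
        simp [upperTri, upperTriHat, upperTriStep, Matrix.mul_apply, Fin.sum_univ_three,
          mul_assoc, hK, h]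
      all_goals noncomm_ring
    · ext i j
      fin_cases i <;> fin_cases j <;>
        simp [upperTri, upperTriHat, upperTriStep, Matrix.mul_apply, Fin.sum_univ_three,
          mul_assoc, hK]

end StrongInvertibility
section FreeHopf

universe u

/-- The relations `∑ r, s d i r * s (d+1) j r = δ i j` and `∑ r, s (d+1) r i * s d r j = δ i j`. -/
inductive FreeHopfRel (k : Type u) [CommRing k] (n : ℕ) :
    FreeAlgebra k (ℤ × Fin n × Fin n) → FreeAlgebra k (ℤ × Fin n × Fin n) → Prop
  | row (d : ℤ) (i j : Fin n) : FreeHopfRel k n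
      (∑ r, FreeAlgebra.ι k (d, i, r) * FreeAlgebra.ι k (d + 1, j, r)) (if i = j then 1 else 0)
  | col (d : ℤ) (i j : Fin n) : FreeHopfRel k n
      (∑ r, FreeAlgebra.ι k (d + 1, r, i) * FreeAlgebra.ι k (d, r, j)) (if i = j then 1 else 0)

/-- The quotient of the free algebra on `s d i j` (`d ∈ ℤ`) by the relations above. -/
abbrev FreeHopf (k : Type u) [CommRing k] (n : ℕ) : Type u := RingQuot (FreeHopfRel k n)

namespace FreeHopf

variable {k : Type u} [CommRing k] {n : ℕ}

/-- The generators `s d i j`. -/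
noncomputable def s (d : ℤ) (i j : Fin n) : FreeHopf k n :=
  RingQuot.mkAlgHom k (FreeHopfRel k n) (FreeAlgebra.ι k (d, i, j))

theorem row (d : ℤ) (i j : Fin n) :
    ∑ r, (s d i r * s (d + 1) j r : FreeHopf k n) = if i = j then 1 else 0 := by
  have := RingQuot.mkAlgHom_rel k (FreeHopfRel.row (k := k) d i j)
  simpa [s, apply_ite] using this

theorem col (d : ℤ) (i j : Fin n) :
    ∑ r, (s (d + 1) r i * s d r j : FreeHopf k n) = if i = j then 1 else 0 := by
  have := RingQuot.mkAlgHom_rel k (FreeHopfRel.col (k := k) d i j)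
  simpa [s, apply_ite] using this

/-- The universal property. -/
noncomputable def lift {E : Type*} [Semiring E] [Algebra k E] (f : ℤ → Fin n → Fin n → E)
    (hrow : ∀ d i j, ∑ r, f d i r * f (d + 1) j r = if i = j then 1 else 0)
    (hcol : ∀ d i j, ∑ r, f (d + 1) r i * f d r j = if i = j then 1 else 0) :
    FreeHopf k n →ₐ[k] E :=
  RingQuot.liftAlgHom k ⟨FreeAlgebra.lift k fun p => f p.1 p.2.1 p.2.2, by
    rintro _ _ (⟨d, i, j⟩ | ⟨d, i, j⟩)
    · simpa [apply_ite] using hrow d i j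
    · simpa [apply_ite] using hcol d i j⟩

@[simp]
theorem lift_s {E : Type*} [Semiring E] [Algebra k E] (f : ℤ → Fin n → Fin n → E)
    (hrow : ∀ d i j, ∑ r, f d i r * f (d + 1) j r = if i = j then 1 else 0)
    (hcol : ∀ d i j, ∑ r, f (d + 1) r i * f d r j = if i = j then 1 else 0) (d : ℤ) (i j : Fin n) :
    lift f hrow hcol (s d i j : FreeHopf k n) = f d i j := by
  simp [lift, s, RingQuot.liftAlgHom_mkAlgHom_apply]

theorem algHom_ext {E : Type*} [Semiring E] [Algebra k E] {f g : FreeHopf k n →ₐ[k] E}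
    (h : ∀ d i j, f (s d i j) = g (s d i j)) : f = g := by
  refine RingQuot.ringQuot_ext' _ _ _ (FreeAlgebra.hom_ext ?_)
  funext p
  exact h p.1 p.2.1 p.2.2

theorem induction {C : FreeHopf k n → Prop} (halg : ∀ r, C (algebraMap k _ r))
    (hs : ∀ d i j, C (s d i j)) (hmul : ∀ a b, C a → C b → C (a * b))
    (hadd : ∀ a b, C a → C b → C (a + b)) (x : FreeHopf k n) : C x := by
  obtain ⟨a, rfl⟩ := RingQuot.mkAlgHom_surjective k (FreeHopfRel k n) x
  induction a using FreeAlgebra.induction with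
  | grade0 r => simpa using halg r
  | grade1 p => exact hs p.1 p.2.1 p.2.2
  | mul a b ha hb => simpa using hmul _ _ ha hb
  | add a b ha hb => simpa using hadd _ _ ha hb

/-- `Δ (s d i j) = ∑ r, s d i r ⊗ s d r j`. -/
noncomputable def comulHom : FreeHopf k n →ₐ[k] FreeHopf k n ⊗[k] FreeHopf k n :=
  lift (fun d i j => ∑ r, (s d i r : FreeHopf k n) ⊗ₜ[k] (s d r j : FreeHopf k n))
    (fun d i j => by
      simp only [Finset.sum_mul_sum, Algebra.TensorProduct.tmul_mul_tmul]
      rw [Finset.sum_comm]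
      conv_lhs => enter [2, p]; rw [Finset.sum_comm]
      simp only [← TensorProduct.tmul_sum, row]
      simp [TensorProduct.tmul_ite, row, ← TensorProduct.sum_tmul,
        Algebra.TensorProduct.one_def, TensorProduct.ite_tmul])
    (fun d i j => by
      simp only [Finset.sum_mul_sum, Algebra.TensorProduct.tmul_mul_tmul]
      rw [Finset.sum_comm]
      conv_lhs => enter [2, p]; rw [Finset.sum_comm]
      simp only [← TensorProduct.sum_tmul, col]
      simp [TensorProduct.ite_tmul, col, ← TensorProduct.tmul_sum,
        Algebra.TensorProduct.one_def, TensorProduct.tmul_ite])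

/-- `ε (s d i j) = δ i j`. -/
noncomputable def counitHom : FreeHopf k n →ₐ[k] k :=
  lift (fun _ i j => if i = j then 1 else 0) (fun d i j => by simp)
    (fun d i j => by simp [eq_comm])

/-- The antipode `S (s d i j) = s (d + 1) j i`, as a homomorphism to the opposite algebra. -/
noncomputable def antipodeHom : FreeHopf k n →ₐ[k] (FreeHopf k n)ᵐᵒᵖ :=
  lift (fun d i j => MulOpposite.op (s (d + 1) j i))
    (fun d i j => by
      have := congrArg MulOpposite.op (col (k := k) (d + 1) j i)
      simpa [apply_ite, eq_comm] using this)
    (fun d i j => by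
      have := congrArg MulOpposite.op (row (k := k) (d + 1) j i)
      simpa [apply_ite, eq_comm] using this)

noncomputable instance : Bialgebra k (FreeHopf k n) :=
  Bialgebra.ofAlgHom comulHom counitHom
    (algHom_ext fun d i j => by
      simp [comulHom, TensorProduct.tmul_sum, TensorProduct.sum_tmul]
      exact Finset.sum_comm)
    (algHom_ext fun d i j => by
      simp [comulHom, counitHom, TensorProduct.ite_tmul])
    (algHom_ext fun d i j => by
      simp [comulHom, counitHom, TensorProduct.tmul_ite])

theorem comul_s (d : ℤ) (i j : Fin n) :
    comul (R := k) (s d i j : FreeHopf k n) = ∑ r, s d i r ⊗ₜ[k] s d r j := by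
  change comulHom _ = _
  simp [comulHom]

theorem counit_s (d : ℤ) (i j : Fin n) :
    counit (R := k) (s d i j : FreeHopf k n) = if i = j then 1 else 0 := by
  change counitHom _ = _
  simp [counitHom]

/-- The antipode as a linear map. -/
noncomputable def antipodeLin : FreeHopf k n →ₗ[k] FreeHopf k n :=
  (MulOpposite.opLinearEquiv k).symm.toLinearMap ∘ₗ antipodeHom.toLinearMap

theorem antipodeLin_mul (a b : FreeHopf k n) :
    antipodeLin (a * b) = antipodeLin b * antipodeLin a := by
  simp [antipodeLin]

theorem antipodeLin_algebraMap (r : k) :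
    antipodeLin (algebraMap k (FreeHopf k n) r) = algebraMap k _ r := by
  simp [antipodeLin]

theorem antipodeLin_one : antipodeLin (1 : FreeHopf k n) = 1 := by
  simp [antipodeLin]

theorem antipodeLin_s (d : ℤ) (i j : Fin n) :
    antipodeLin (s d i j : FreeHopf k n) = s (d + 1) j i := by
  simp [antipodeLin, antipodeHom]

theorem antipode_left (x : FreeHopf k n) :
    LinearMap.mul' k _ (antipodeLin.rTensor (FreeHopf k n) (comul x)) =
      algebraMap k _ (counit x) := by
  induction x using FreeHopf.induction with
  | halg r =>
    rw [Bialgebra.comul_algebraMap, Bialgebra.counit_algebraMap,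
      Algebra.TensorProduct.algebraMap_apply]
    simp [antipodeLin_algebraMap]
  | hs d i j =>
    simp only [comul_s, counit_s, map_sum, LinearMap.rTensor_tmul, LinearMap.mul'_apply,
      antipodeLin_s, col]
    split_ifs <;> simp
  | hadd a b ha hb => simp [ha, hb]
  | hmul a b ha hb =>
    have ha' := ha
    have hb' := hb
    rw [← (ℛ k a).eq] at ha'
    rw [← (ℛ k b).eq] at hb'
    rw [Bialgebra.comul_mul, ← (ℛ k a).eq, ← (ℛ k b).eq, Bialgebra.counit_mul, map_mul (algebraMap k _)]
    simp only [Finset.sum_mul_sum, Algebra.TensorProduct.tmul_mul_tmul, map_sum,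
      LinearMap.rTensor_tmul, LinearMap.mul'_apply, antipodeLin_mul] at ha' hb' ⊢
    rw [Finset.sum_comm, ← hb', Finset.mul_sum]
    refine Finset.sum_congr rfl fun j _ => ?_
    have : ∀ x y : FreeHopf k n, ∀ z w : FreeHopf k n, x * y * (z * w) = x * (y * z) * w := by
      intros; noncomm_ring
    simp only [this, ← Finset.mul_sum, ← Finset.sum_mul, ha']
    rw [← Algebra.commutes, mul_assoc]

theorem antipode_right (x : FreeHopf k n) :
    LinearMap.mul' k _ (antipodeLin.lTensor (FreeHopf k n) (comul x)) =
      algebraMap k _ (counit x) := by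
  induction x using FreeHopf.induction with
  | halg r =>
    rw [Bialgebra.comul_algebraMap, Bialgebra.counit_algebraMap,
      Algebra.TensorProduct.algebraMap_apply]
    simp [antipodeLin_one]
  | hs d i j =>
    simp only [comul_s, counit_s, map_sum, LinearMap.lTensor_tmul, LinearMap.mul'_apply,
      antipodeLin_s, row]
    split_ifs <;> simp
  | hadd a b ha hb => simp [ha, hb]
  | hmul a b ha hb =>
    have ha' := ha
    have hb' := hb
    rw [← (ℛ k a).eq] at ha'
    rw [← (ℛ k b).eq] at hb'
    rw [Bialgebra.comul_mul, ← (ℛ k a).eq, ← (ℛ k b).eq, Bialgebra.counit_mul, map_mul (algebraMap k _)]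
    simp only [Finset.sum_mul_sum, Algebra.TensorProduct.tmul_mul_tmul, map_sum,
      LinearMap.lTensor_tmul, LinearMap.mul'_apply, antipodeLin_mul] at ha' hb' ⊢
    rw [← ha', Finset.sum_mul]
    refine Finset.sum_congr rfl fun j _ => ?_
    have : ∀ x y : FreeHopf k n, ∀ z w : FreeHopf k n, x * y * (z * w) = x * (y * z) * w := by
      intros; noncomm_ring
    simp only [this, ← Finset.mul_sum, ← Finset.sum_mul, hb']
    rw [mul_assoc, mul_assoc, Algebra.commutes]

noncomputable instance : HopfAlgebra k (FreeHopf k n) where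
  antipode := antipodeLin
  mul_antipode_rTensor_comul := LinearMap.ext antipode_left
  mul_antipode_lTensor_comul := LinearMap.ext antipode_right

theorem antipode_s (d : ℤ) (i j : Fin n) :
    antipode k (s d i j : FreeHopf k n) = s (d + 1) j i := antipodeLin_s d i j

end FreeHopf

end FreeHopf

section HopfImage

variable {k H E : Type*} [CommRing k] [Ring H] [HopfAlgebra k H] [Ring E] [Algebra k E]

/-- The Hopf ideals of `H` contained in the kernel of the representation `φ`. -/
def hopfIdealsBelow (φ : H →ₐ[k] E) : Set (Ideal H) :=
  {I | I.IsTwoSided ∧ I.IsHopfIdeal k ∧ ∀ x ∈ I, φ x = 0}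

/-- The sum of all Hopf ideals contained in the kernel of `φ`. -/
def hopfCore (φ : H →ₐ[k] E) : Ideal H := sSup (hopfIdealsBelow φ)

theorem hopfCore_induction (φ : H →ₐ[k] E) {C : H → Prop} (h0 : C 0)
    (hadd : ∀ x y, C x → C y → C (x + y)) (h : ∀ I ∈ hopfIdealsBelow φ, ∀ x ∈ I, C x)
    {x : H} (hx : x ∈ hopfCore φ) : C x := by
  rw [hopfCore, sSup_eq_iSup'] at hx
  exact Submodule.iSup_induction _ (motive := C) hx (fun I x hx => h I.1 I.2 x hx) h0 hadd

instance (φ : H →ₐ[k] E) : (hopfCore φ).IsTwoSided where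
  mul_mem_of_left {a} b ha := by
    refine hopfCore_induction φ (C := fun a => a * b ∈ hopfCore φ) (by simp)
      (fun x y hx hy => by rw [add_mul]; exact add_mem hx hy) (fun I hI x hx => ?_) ha
    have := hI.1
    exact le_sSup (a := I) hI (I.mul_mem_right b hx)

instance (φ : H →ₐ[k] E) : (hopfCore φ).IsHopfIdeal k where
  counit_eq_zero x hx := by
    refine hopfCore_induction φ (C := fun x => counit (R := k) x = 0) (by simp)
      (fun x y hx hy => by rw [map_add, hx, hy, add_zero]) (fun I hI x hx => ?_) hx
    have := hI.2.1
    exact this.counit_eq_zero hx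
  map_mkQ_comul_eq_zero x hx := by
    refine hopfCore_induction φ (C := fun x => TensorProduct.map
        ((hopfCore φ).restrictScalars k).mkQ ((hopfCore φ).restrictScalars k).mkQ
        (comul (R := k) x) = 0) (by simp)
      (fun x y hx hy => by rw [map_add, map_add, hx, hy, add_zero]) (fun I hI x hx => ?_) hx
    have hle : I.restrictScalars k ≤ (hopfCore φ).restrictScalars k := le_sSup (a := I) hI
    have h1 : ((hopfCore φ).restrictScalars k).mkQ =
        Submodule.mapQ _ _ LinearMap.id hle ∘ₗ (I.restrictScalars k).mkQ := rfl
    have := hI.2.1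
    rw [h1, TensorProduct.map_comp, LinearMap.comp_apply, this.map_mkQ_comul_eq_zero hx, map_zero]
  antipode_mem x hx := by
    refine hopfCore_induction φ (C := fun x => antipode k x ∈ hopfCore φ) (by simp)
      (fun x y hx hy => by rw [map_add]; exact add_mem hx hy) (fun I hI x hx => ?_) hx
    have := hI.2.1
    exact le_sSup (a := I) hI (this.antipode_mem hx)

/-- The Hopf image of `φ`: the quotient of `H` by the sum of all Hopf ideals in `ker φ`. -/
abbrev HopfImage (φ : H →ₐ[k] E) : Type _ := H ⧸ hopfCore φ

/-- The representation of the Hopf image induced by `φ`. -/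
def hopfImageRep (φ : H →ₐ[k] E) : HopfImage φ →ₐ[k] E :=
  Ideal.Quotient.liftₐ (hopfCore φ) φ fun _ hx =>
    hopfCore_induction φ (C := fun x => φ x = 0) (map_zero φ)
      (fun x y hx hy => by rw [map_add, hx, hy, add_zero]) (fun _ hI => hI.2.2) hx

end HopfImage
section TensorLemmas

variable {k : Type*} [Field k]

/-- Over a field, evaluation `V ⊗ W → (M ⊗ N)^*` is injective if `V ⊆ M^*` and `W ⊆ N^*`. -/
theorem dualDistrib_injective {V W M N : Type*} [AddCommGroup V] [Module k V] [AddCommGroup W]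
    [Module k W] [AddCommGroup M] [Module k M] [AddCommGroup N] [Module k N]
    (f : V →ₗ[k] Module.Dual k M) (g : W →ₗ[k] Module.Dual k N)
    (hf : Function.Injective f) (hg : Function.Injective g) :
    Function.Injective (TensorProduct.dualDistrib k M N ∘ₗ TensorProduct.map f g) := by
  rw [← LinearMap.ker_eq_bot, LinearMap.ker_eq_bot']
  intro t ht
  classical
  let b := Module.Basis.ofVectorSpace k V
  set c := TensorProduct.equivFinsuppOfBasisLeft (N := W) b t with hc
  have htc : t = c.sum fun i w => b i ⊗ₜ[k] w := by
    rw [← TensorProduct.equivFinsuppOfBasisLeft_symm_apply, hc, LinearEquiv.symm_apply_apply]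
  suffices c = 0 by rw [htc, this]; simp
  ext i
  apply hg
  rw [Finsupp.coe_zero, Pi.zero_apply, map_zero]
  ext y
  have h1 : ∑ j ∈ c.support, (g (c j) y) • b j = 0 := by
    apply hf
    ext x
    have := LinearMap.congr_fun ht (x ⊗ₜ y)
    rw [htc] at this
    simp only [Finsupp.sum, map_sum, LinearMap.comp_apply, TensorProduct.map_tmul,
      LinearMap.sum_apply, TensorProduct.dualDistrib_apply, LinearMap.zero_apply] at this
    simp only [map_sum, map_smul, LinearMap.sum_apply, LinearMap.smul_apply, map_zero,
      LinearMap.zero_apply, smul_eq_mul]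
    rw [← this]
    exact Finset.sum_congr rfl fun j _ => mul_comm _ _
  by_cases hi : i ∈ c.support
  · exact linearIndependent_iff'.1 b.linearIndependent c.support _ h1 i hi
  · simp [Finsupp.notMem_support_iff.1 hi]

/-- A tensor is zero if all its right slices vanish. -/
theorem eq_zero_of_slices {V W : Type*} [AddCommGroup V] [Module k V] [AddCommGroup W]
    [Module k W] (t : V ⊗[k] W)
    (h : ∀ g : Module.Dual k W, TensorProduct.rid k V (g.lTensor V t) = 0) : t = 0 := by
  classical
  let b := Module.Basis.ofVectorSpace k W
  apply (TensorProduct.equivFinsuppOfBasisRight (M := V) b).injective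
  ext i
  rw [TensorProduct.equivFinsuppOfBasisRight_apply, h]
  simp

theorem eq_zero_of_slices_left {V W : Type*} [AddCommGroup V] [Module k V] [AddCommGroup W]
    [Module k W] (t : V ⊗[k] W)
    (h : ∀ g : Module.Dual k V, TensorProduct.lid k W (g.rTensor W t) = 0) : t = 0 := by
  classical
  let b := Module.Basis.ofVectorSpace k V
  apply (TensorProduct.equivFinsuppOfBasisLeft (N := W) b).injective
  ext i
  rw [TensorProduct.equivFinsuppOfBasisLeft_apply, h]
  simp

/-- Over a field, a tensor lies in the image of `A ⊗ A` iff all of its slices lie in `A`. -/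
theorem mem_range_mapIncl_iff {V : Type*} [AddCommGroup V] [Module k V] (A : Submodule k V)
    (t : V ⊗[k] V) :
    t ∈ LinearMap.range (TensorProduct.mapIncl A A) ↔
      (∀ g : Module.Dual k V, TensorProduct.rid k V (g.lTensor V t) ∈ A) ∧
      (∀ g : Module.Dual k V, TensorProduct.lid k V (g.rTensor V t) ∈ A) := by
  constructor
  · rintro ⟨t, rfl⟩
    induction t using TensorProduct.induction_on with
    | zero => simp
    | tmul x y =>
      simp only [TensorProduct.mapIncl, TensorProduct.map_tmul, LinearMap.lTensor_tmul,
        LinearMap.rTensor_tmul, TensorProduct.rid_tmul, TensorProduct.lid_tmul,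
        Submodule.subtype_apply]
      exact ⟨fun g => A.smul_mem _ x.2, fun g => A.smul_mem _ y.2⟩
    | add x y hx hy =>
      simp only [map_add]
      exact ⟨fun g => A.add_mem (hx.1 g) (hy.1 g), fun g => A.add_mem (hx.2 g) (hy.2 g)⟩
  · rintro ⟨h1, h2⟩
    obtain ⟨p, hp⟩ := A.subtype.exists_leftInverse_of_injective A.ker_subtype
    have hpA : ∀ x ∈ A, (p x : V) = x := fun x hx =>
      congrArg Subtype.val (LinearMap.congr_fun hp ⟨x, hx⟩)
    let q : V →ₗ[k] V := A.subtype ∘ₗ p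
    have hq : ∀ x ∈ A, q x = x := hpA
    have e1 : q.rTensor V t = t := by
      rw [← sub_eq_zero]
      apply eq_zero_of_slices
      intro g
      have : TensorProduct.rid k V (g.lTensor V (q.rTensor V t)) =
          q (TensorProduct.rid k V (g.lTensor V t)) := by
        clear h1 h2
        induction t using TensorProduct.induction_on with
        | zero => simp
        | tmul x y => simp
        | add x y hx hy => simp only [map_add, hx, hy]
      rw [map_sub, map_sub, this, hq _ (h1 g), sub_self]
    have e2 : q.lTensor V t = t := by
      rw [← sub_eq_zero]
      apply eq_zero_of_slices_left
      intro g
      have : TensorProduct.lid k V (g.rTensor V (q.lTensor V t)) =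
          q (TensorProduct.lid k V (g.rTensor V t)) := by
        clear h1 h2 e1
        induction t using TensorProduct.induction_on with
        | zero => simp
        | tmul x y => simp
        | add x y hx hy => simp only [map_add, hx, hy]
      rw [map_sub, map_sub, this, hq _ (h2 g), sub_self]
    refine ⟨TensorProduct.map p p t, ?_⟩
    rw [TensorProduct.mapIncl, ← LinearMap.comp_apply, ← TensorProduct.map_comp]
    change TensorProduct.map q q t = t
    rw [← LinearMap.rTensor_comp_lTensor, LinearMap.comp_apply, e2, e1]

end TensorLemmas

section HopfSubalgebra

variable {k H : Type*} [Field k] [Ring H] [HopfAlgebra k H]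

/-- A Hopf subalgebra: a subalgebra `A` with `Δ(A) ⊆ A ⊗ A` and `S(A) ⊆ A`. -/
class IsHopfSubalgebra (A : Subalgebra k H) : Prop where
  comul_mem : ∀ x ∈ A, comul (R := k) x ∈ LinearMap.range
    (TensorProduct.mapIncl (Subalgebra.toSubmodule A) (Subalgebra.toSubmodule A))
  antipode_mem : ∀ x ∈ A, antipode k x ∈ A

/-- The Hopf subalgebra generated by a set. -/
def hopfClosure (S : Set H) : Subalgebra k H :=
  sInf {A : Subalgebra k H | IsHopfSubalgebra A ∧ S ⊆ A}

theorem subset_hopfClosure (S : Set H) : S ⊆ (hopfClosure S : Subalgebra k H) := by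
  intro x hx
  rw [hopfClosure, SetLike.mem_coe, Algebra.mem_sInf]
  exact fun A hA => hA.2 hx

theorem hopfClosure_le {S : Set H} (A : Subalgebra k H) [hA : IsHopfSubalgebra A]
    (h : S ⊆ A) : hopfClosure S ≤ A := sInf_le ⟨hA, h⟩

instance (S : Set H) : IsHopfSubalgebra (hopfClosure S : Subalgebra k H) where
  comul_mem x hx := by
    rw [hopfClosure, Algebra.mem_sInf] at hx
    rw [mem_range_mapIncl_iff]
    simp only [Subalgebra.mem_toSubmodule]
    simp only [hopfClosure, Algebra.mem_sInf]
    exact ⟨fun g A hA => ((mem_range_mapIncl_iff _ _).1 (hA.1.comul_mem x (hx A hA))).1 g,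
      fun g A hA => ((mem_range_mapIncl_iff _ _).1 (hA.1.comul_mem x (hx A hA))).2 g⟩
  antipode_mem x hx := by
    rw [hopfClosure, Algebra.mem_sInf] at hx ⊢
    exact fun A hA => hA.1.antipode_mem x (hx A hA)

namespace IsHopfSubalgebra

variable (A : Subalgebra k H)

theorem map_val_injective : Function.Injective
    (TensorProduct.map A.val.toLinearMap A.val.toLinearMap) :=
  TensorProduct.map_injective_of_flat_flat _ _ Subtype.val_injective Subtype.val_injective

theorem map_val_injective₃ : Function.Injective (TensorProduct.map A.val.toLinearMap
    (TensorProduct.map A.val.toLinearMap A.val.toLinearMap)) :=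
  TensorProduct.map_injective_of_flat_flat _ _ Subtype.val_injective (map_val_injective A)

/-- The inclusion `A ⊗ A → H ⊗ H`. -/
noncomputable def incl₂ : A ⊗[k] A →ₐ[k] H ⊗[k] H := Algebra.TensorProduct.map A.val A.val

theorem incl₂_injective : Function.Injective (incl₂ A) := map_val_injective A

variable [hA : IsHopfSubalgebra A]

/-- The restriction of the coproduct. -/
noncomputable def comulHom : A →ₐ[k] A ⊗[k] A :=
  (AlgEquiv.ofInjective (incl₂ A) (incl₂_injective A)).symm.toAlgHom.comp
    (((Bialgebra.comulAlgHom k H).comp A.val).codRestrict (incl₂ A).range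
      fun x => hA.comul_mem x x.2)

theorem incl₂_comulHom (x : A) : incl₂ A (comulHom A x) = comul (R := k) (x : H) :=
  congrArg Subtype.val ((AlgEquiv.ofInjective (incl₂ A) (incl₂_injective A)).apply_symm_apply
    (((Bialgebra.comulAlgHom k H).comp A.val).codRestrict (incl₂ A).range
      (fun x => hA.comul_mem x x.2) x))

theorem map_val_comp_comulHom :
    TensorProduct.map A.val.toLinearMap A.val.toLinearMap ∘ₗ (comulHom A).toLinearMap =
      comul ∘ₗ A.val.toLinearMap := LinearMap.ext (incl₂_comulHom A)

noncomputable instance : Bialgebra k A :=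
  Bialgebra.ofAlgHom (comulHom A) ((Bialgebra.counitAlgHom k H).comp A.val)
    (by
      apply AlgHom.toLinearMap_injective
      rw [← LinearMap.cancel_left (map_val_injective₃ A)]
      have h := map_val_comp_comulHom A
      set ι := A.val.toLinearMap
      have e1 : TensorProduct.map ι (TensorProduct.map ι ι) ∘ₗ
          (TensorProduct.assoc k A A A).toLinearMap =
          (TensorProduct.assoc k H H H).toLinearMap ∘ₗ
            TensorProduct.map (TensorProduct.map ι ι) ι := by
        ext; rfl
      have e2 : ((Algebra.TensorProduct.assoc k k k A A A).toAlgHom.comp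
          ((Algebra.TensorProduct.map (comulHom A) (.id k A)).comp (comulHom A))).toLinearMap =
          (TensorProduct.assoc k A A A).toLinearMap ∘ₗ
            TensorProduct.map (comulHom A).toLinearMap LinearMap.id ∘ₗ
              (comulHom A).toLinearMap := rfl
      have e3 : ((Algebra.TensorProduct.map (.id k A) (comulHom A)).comp
          (comulHom A)).toLinearMap =
            TensorProduct.map LinearMap.id (comulHom A).toLinearMap ∘ₗ
              (comulHom A).toLinearMap := rfl
      have f1 : TensorProduct.map (TensorProduct.map ι ι) ι ∘ₗ
          TensorProduct.map (comulHom A).toLinearMap LinearMap.id =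
          TensorProduct.map comul LinearMap.id ∘ₗ TensorProduct.map ι ι := by
        rw [← TensorProduct.map_comp, ← TensorProduct.map_comp, h]; rfl
      have f2 : TensorProduct.map ι (TensorProduct.map ι ι) ∘ₗ
          TensorProduct.map LinearMap.id (comulHom A).toLinearMap =
          TensorProduct.map LinearMap.id comul ∘ₗ TensorProduct.map ι ι := by
        rw [← TensorProduct.map_comp, ← TensorProduct.map_comp, h]; rfl
      rw [e2, e3, ← LinearMap.comp_assoc, e1, LinearMap.comp_assoc,
        ← LinearMap.comp_assoc (comulHom A).toLinearMap, f1, ← LinearMap.comp_assoc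
        (comulHom A).toLinearMap _ (TensorProduct.map ι (TensorProduct.map ι ι)), f2,
        LinearMap.comp_assoc, LinearMap.comp_assoc, h,
        ← LinearMap.comp_assoc, ← LinearMap.comp_assoc, ← LinearMap.comp_assoc]
      congr 1
      rw [LinearMap.comp_assoc]
      exact Coalgebra.coassoc)
    (by
      ext x
      apply (Module.Flat.lTensor_preserves_injective_linearMap (M := k) A.val.toLinearMap
        Subtype.val_injective)
      have := Coalgebra.rTensor_counit_comul (R := k) (x : H)
      rw [← incl₂_comulHom] at this
      simp only [AlgHom.comp_apply]
      generalize comulHom A x = t at this ⊢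
      refine Eq.trans ?_ (this.trans ?_)
      · clear this
        induction t using TensorProduct.induction_on with
        | zero => simp
        | tmul x y => rfl
        | add x y hx hy => simp only [map_add, hx, hy]
      · simp)
    (by
      ext x
      apply (Module.Flat.rTensor_preserves_injective_linearMap (M := k) A.val.toLinearMap
        Subtype.val_injective)
      have := Coalgebra.lTensor_counit_comul (R := k) (x : H)
      rw [← incl₂_comulHom] at this
      simp only [AlgHom.comp_apply]
      generalize comulHom A x = t at this ⊢
      refine Eq.trans ?_ (this.trans ?_)
      · clear this
        induction t using TensorProduct.induction_on with
        | zero => simp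
        | tmul x y => rfl
        | add x y hx hy => simp only [map_add, hx, hy]
      · simp)

theorem map_val_comul (x : A) : TensorProduct.map A.val.toLinearMap A.val.toLinearMap
    (comul (R := k) x) = comul (R := k) (x : H) := incl₂_comulHom A x

theorem counit_coe (x : A) : counit (R := k) (x : H) = counit (R := k) x := rfl

/-- The restriction of the antipode. -/
noncomputable def antipodeLin : A →ₗ[k] A :=
  (antipode k ∘ₗ A.val.toLinearMap).codRestrict (Subalgebra.toSubmodule A)
    fun x => hA.antipode_mem x x.2

noncomputable instance : HopfAlgebra k A where
  antipode := antipodeLin A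
  mul_antipode_rTensor_comul := by
    ext x
    have := mul_antipode_rTensor_comul_apply (R := k) (x : H)
    rw [← map_val_comul, counit_coe] at this
    refine Eq.trans ?_ this
    simp only [LinearMap.comp_apply]
    generalize comul (R := k) x = t
    induction t using TensorProduct.induction_on with
    | zero => simp
    | tmul x y => rfl
    | add x y hx hy => simp only [map_add, Subalgebra.coe_add, hx, hy]
  mul_antipode_lTensor_comul := by
    ext x
    have := mul_antipode_lTensor_comul_apply (R := k) (x : H)
    rw [← map_val_comul, counit_coe] at this
    refine Eq.trans ?_ this
    simp only [LinearMap.comp_apply]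
    generalize comul (R := k) x = t
    induction t using TensorProduct.induction_on with
    | zero => simp
    | tmul x y => rfl
    | add x y hx hy => simp only [map_add, Subalgebra.coe_add, hx, hy]

theorem coe_antipode (x : A) : ((antipode k x : A) : H) = antipode k (x : H) := rfl

end IsHopfSubalgebra

end HopfSubalgebra
section FiniteDual

variable (k H : Type*) [Field k] [Ring H] [HopfAlgebra k H]

/-- The full linear dual of `H` with the convolution product. -/
abbrev ConvDual : Type _ := WithConv (H →ₗ[k] k)

variable {k H}

/-- A functional is representative if it vanishes on a two-sided ideal of finite codimension. -/
def IsRepresentative (f : H →ₗ[k] k) : Prop :=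
  ∃ J : Ideal H, J.IsTwoSided ∧ Module.Finite k (H ⧸ J) ∧ ∀ x ∈ J, f x = 0

theorem isRepresentative_of_algHom {E : Type*} [Ring E] [Algebra k E] [Module.Finite k E]
    (φ : H →ₐ[k] E) (f : H →ₗ[k] k) (h : ∀ x, φ x = 0 → f x = 0) : IsRepresentative f := by
  refine ⟨RingHom.ker φ, inferInstance, ?_, fun x hx => h x hx⟩
  exact Module.Finite.of_injective
    ((Ideal.kerLiftAlg φ).toLinearMap : (H ⧸ RingHom.ker φ) →ₗ[k] E) (Ideal.kerLiftAlg_injective φ)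

theorem IsRepresentative.exists_algHom {f : H →ₗ[k] k} (hf : IsRepresentative f) :
    ∃ J : Ideal H, ∃ _ : J.IsTwoSided, Module.Finite k (H ⧸ J) ∧
      ∃ g : (H ⧸ J) →ₗ[k] k, f = g ∘ₗ (Ideal.Quotient.mkₐ k J).toLinearMap := by
  obtain ⟨J, hJ, hfin, h⟩ := hf
  exact ⟨J, hJ, hfin, (J.restrictScalars k).liftQ f h, LinearMap.ext fun x => rfl⟩

theorem isRepresentative_comp {E : Type*} [Ring E] [Algebra k E] [Module.Finite k E]
    (φ : H →ₐ[k] E) (g : E →ₗ[k] k) : IsRepresentative (g ∘ₗ φ.toLinearMap) :=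
  isRepresentative_of_algHom φ _ fun x hx => by simp [hx]

variable (k H) in
/-- The representative functionals, as a subalgebra of the convolution algebra. -/
def representativeFunctionals : Subalgebra k (ConvDual k H) where
  carrier := {f | IsRepresentative f.ofConv}
  mul_mem' {f g} hf hg := by
    obtain ⟨I, _, _, f', hf'⟩ := IsRepresentative.exists_algHom hf
    obtain ⟨J, _, _, g', hg'⟩ := IsRepresentative.exists_algHom hg
    refine isRepresentative_of_algHom ((Algebra.TensorProduct.map (Ideal.Quotient.mkₐ k I)
      (Ideal.Quotient.mkₐ k J)).comp (Bialgebra.comulAlgHom k H)) _ fun x hx => ?_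
    change LinearMap.mul' k k (TensorProduct.map f.ofConv g.ofConv (comul x)) = 0
    rw [hf', hg', TensorProduct.map_comp, LinearMap.comp_apply]
    refine (congrArg (fun z => LinearMap.mul' k k (TensorProduct.map f' g' z)) hx).trans ?_
    simp
  add_mem' {f g} hf hg := by
    obtain ⟨I, _, _, f', hf'⟩ := IsRepresentative.exists_algHom hf
    obtain ⟨J, _, _, g', hg'⟩ := IsRepresentative.exists_algHom hg
    refine isRepresentative_of_algHom ((Ideal.Quotient.mkₐ k I).prod
      (Ideal.Quotient.mkₐ k J)) _ fun x hx => ?_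
    have h1 : Ideal.Quotient.mkₐ k I x = 0 := congrArg Prod.fst hx
    have h2 : Ideal.Quotient.mkₐ k J x = 0 := congrArg Prod.snd hx
    change f.ofConv x + g.ofConv x = 0
    rw [hf', hg']
    simp only [LinearMap.comp_apply, AlgHom.toLinearMap_apply, h1, h2, map_zero, add_zero]
  algebraMap_mem' r := by
    refine isRepresentative_of_algHom (Bialgebra.counitAlgHom k H) _ fun x hx => ?_
    have hx' : counit (R := k) x = 0 := hx
    change r • algebraMap k k (counit x) = 0
    rw [hx', map_zero, smul_zero]

variable (k H) in
/-- The Hopf dual `H°`: the algebra of representative functionals. -/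
def FiniteDual : Type _ := representativeFunctionals k H

namespace FiniteDual

noncomputable instance : Ring (FiniteDual k H) :=
  inferInstanceAs (Ring (representativeFunctionals k H))

noncomputable instance : Algebra k (FiniteDual k H) :=
  inferInstanceAs (Algebra k (representativeFunctionals k H))

/-- Evaluation of a functional. -/
def eval (f : FiniteDual k H) (x : H) : k := f.1.ofConv x

instance : CoeFun (FiniteDual k H) fun _ => H → k := ⟨eval⟩

theorem ext {f g : FiniteDual k H} (h : ∀ x, f x = g x) : f = g :=
  Subtype.ext (WithConv.ext (LinearMap.ext h))

/-- A representative functional as an element of the Hopf dual. -/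
def mk (f : H →ₗ[k] k) (hf : IsRepresentative f) : FiniteDual k H := ⟨WithConv.toConv f, hf⟩

variable (k H) in
/-- The inclusion of the Hopf dual into the linear dual. -/
def toDual : FiniteDual k H →ₗ[k] Module.Dual k H where
  toFun f := f.1.ofConv
  map_add' _ _ := rfl
  map_smul' _ _ := rfl

theorem toDual_injective : Function.Injective (toDual k H) := fun _ _ h => ext (LinearMap.congr_fun h)

variable (k H) in
/-- The pairing `⟨f ⊗ g, x ⊗ y⟩ = f x * g y`. -/
noncomputable def pair₂ : FiniteDual k H ⊗[k] FiniteDual k H →ₗ[k] Module.Dual k (H ⊗[k] H) :=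
  TensorProduct.dualDistrib k H H ∘ₗ TensorProduct.map (toDual k H) (toDual k H)

@[simp] theorem pair₂_tmul (f g : FiniteDual k H) (x y : H) :
    pair₂ k H (f ⊗ₜ g) (x ⊗ₜ y) = f x * g y := rfl

theorem pair₂_injective : Function.Injective (pair₂ k H) :=
  dualDistrib_injective _ _ toDual_injective toDual_injective

variable (k H) in
/-- The pairing `⟨f ⊗ (g ⊗ h), x ⊗ (y ⊗ z)⟩ = f x * (g y * h z)`. -/
noncomputable def pair₃ : FiniteDual k H ⊗[k] (FiniteDual k H ⊗[k] FiniteDual k H) →ₗ[k]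
    Module.Dual k (H ⊗[k] (H ⊗[k] H)) :=
  TensorProduct.dualDistrib k H (H ⊗[k] H) ∘ₗ TensorProduct.map (toDual k H) (pair₂ k H)

theorem pair₃_injective : Function.Injective (pair₃ k H) :=
  dualDistrib_injective _ _ toDual_injective pair₂_injective

theorem ext₂ {s t : FiniteDual k H ⊗[k] FiniteDual k H}
    (h : ∀ x y, pair₂ k H s (x ⊗ₜ y) = pair₂ k H t (x ⊗ₜ y)) : s = t :=
  pair₂_injective (TensorProduct.ext' h)

theorem exists_comul (f : FiniteDual k H) :
    ∃ t : FiniteDual k H ⊗[k] FiniteDual k H, pair₂ k H t = toDual k H f ∘ₗ LinearMap.mul' k H := by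
  obtain ⟨J, _, _, g, hg⟩ := IsRepresentative.exists_algHom f.2
  let π := Ideal.Quotient.mkₐ k J
  let p : Module.Dual k (H ⧸ J) →ₗ[k] FiniteDual k H :=
    { toFun := fun e => mk (e ∘ₗ π.toLinearMap) (isRepresentative_comp π e)
      map_add' := fun _ _ => rfl
      map_smul' := fun _ _ => rfl }
  obtain ⟨u, hu⟩ := (TensorProduct.dualDistribEquiv k (H ⧸ J) (H ⧸ J)).surjective
    (g ∘ₗ LinearMap.mul' k (H ⧸ J))
  refine ⟨TensorProduct.map p p u, TensorProduct.ext' fun x y => ?_⟩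
  have h1 : pair₂ k H (TensorProduct.map p p u) (x ⊗ₜ y) =
      TensorProduct.dualDistribEquiv k (H ⧸ J) (H ⧸ J) u (π x ⊗ₜ π y) := by
    clear hu
    induction u using TensorProduct.induction_on with
    | zero => simp
    | tmul a b => simp; rfl
    | add a b ha hb => simp only [map_add, LinearMap.add_apply, ha, hb]
  rw [h1, hu]
  change g (π x * π y) = f.1.ofConv (x * y)
  rw [← map_mul, hg]
  rfl

/-- The coproduct of the Hopf dual: `f(x * y) = f₁(x) * f₂(y)`. -/
noncomputable def comulLin : FiniteDual k H →ₗ[k] FiniteDual k H ⊗[k] FiniteDual k H where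
  toFun f := (exists_comul f).choose
  map_add' f g := pair₂_injective (by
    refine (exists_comul (f + g)).choose_spec.trans ?_
    rw [map_add (pair₂ k H), (exists_comul f).choose_spec, (exists_comul g).choose_spec]
    rfl)
  map_smul' r f := pair₂_injective (by
    refine (exists_comul (r • f)).choose_spec.trans ?_
    rw [map_smul (pair₂ k H), (exists_comul f).choose_spec]
    rfl)

theorem pair₂_comulLin (f : FiniteDual k H) :
    pair₂ k H (comulLin f) = toDual k H f ∘ₗ LinearMap.mul' k H := (exists_comul f).choose_spec

/-- The counit of the Hopf dual: `f ↦ f 1`. -/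
def counitLin : FiniteDual k H →ₗ[k] k where
  toFun f := f 1
  map_add' _ _ := rfl
  map_smul' _ _ := rfl

noncomputable instance : Coalgebra k (FiniteDual k H) where
  comul := comulLin
  counit := counitLin
  coassoc := by
    ext f
    apply pair₃_injective
    apply TensorProduct.ext'
    intro x yz
    induction yz using TensorProduct.induction_on with
    | zero => simp
    | add a b ha hb => simp only [TensorProduct.tmul_add, map_add, ha, hb]
    | tmul y z =>
      have h1 : ∀ t : FiniteDual k H ⊗[k] FiniteDual k H,
          pair₃ k H (TensorProduct.assoc k _ _ _ (comulLin.rTensor _ t)) (x ⊗ₜ (y ⊗ₜ z)) =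
            pair₂ k H t ((x * y) ⊗ₜ z) := fun t => by
        induction t using TensorProduct.induction_on with
        | zero => simp
        | add a b ha hb => simp only [map_add, LinearMap.add_apply, ha, hb]
        | tmul a b =>
          have h2 : ∀ t : FiniteDual k H ⊗[k] FiniteDual k H,
              pair₃ k H (TensorProduct.assoc k _ _ _ (t ⊗ₜ b)) (x ⊗ₜ (y ⊗ₜ z)) =
                pair₂ k H t (x ⊗ₜ y) * b z := fun t => by
            induction t using TensorProduct.induction_on with
            | zero => simp
            | add a b ha hb =>
              simp only [TensorProduct.add_tmul, map_add, LinearMap.add_apply, ha, hb, add_mul]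
            | tmul u v => exact (mul_assoc (u x) (v y) (b z)).symm
          rw [LinearMap.rTensor_tmul, h2, pair₂_comulLin]
          rfl
      have h3 : ∀ t : FiniteDual k H ⊗[k] FiniteDual k H,
          pair₃ k H (comulLin.lTensor _ t) (x ⊗ₜ (y ⊗ₜ z)) =
            pair₂ k H t (x ⊗ₜ (y * z)) := fun t => by
        induction t using TensorProduct.induction_on with
        | zero => simp
        | add a b ha hb => simp only [map_add, LinearMap.add_apply, ha, hb]
        | tmul a b =>
          change a x * pair₂ k H (comulLin b) (y ⊗ₜ z) = _
          rw [pair₂_comulLin]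
          rfl
      refine (h1 _).trans (Eq.trans ?_ (h3 _).symm)
      rw [pair₂_comulLin]
      exact congrArg (toDual k H f) (mul_assoc x y z)
  rTensor_counit_comp_comul := by
    ext f
    apply (TensorProduct.lid k _).injective
    apply ext
    intro x
    have h1 : ∀ t : FiniteDual k H ⊗[k] FiniteDual k H,
        (TensorProduct.lid k (FiniteDual k H) (counitLin.rTensor _ t)) x =
          pair₂ k H t (1 ⊗ₜ x) := fun t => by
      induction t using TensorProduct.induction_on with
      | zero => simp; rfl
      | add a b ha hb => simp only [map_add, LinearMap.add_apply, ← ha, ← hb]; rfl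
      | tmul a b => rfl
    refine (h1 _).trans ?_
    rw [pair₂_comulLin]
    change f (1 * x) = (TensorProduct.lid k (FiniteDual k H) (1 ⊗ₜ f)) x
    rw [one_mul, TensorProduct.lid_tmul, one_smul]
  lTensor_counit_comp_comul := by
    ext f
    apply (TensorProduct.rid k _).injective
    apply ext
    intro x
    have h1 : ∀ t : FiniteDual k H ⊗[k] FiniteDual k H,
        (TensorProduct.rid k (FiniteDual k H) (counitLin.lTensor _ t)) x =
          pair₂ k H t (x ⊗ₜ 1) := fun t => by
      induction t using TensorProduct.induction_on with
      | zero => simp; rfl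
      | add a b ha hb => simp only [map_add, LinearMap.add_apply, ← ha, ← hb]; rfl
      | tmul a b => exact mul_comm _ _
    refine (h1 _).trans ?_
    rw [pair₂_comulLin]
    change f (x * 1) = (TensorProduct.rid k (FiniteDual k H) (f ⊗ₜ 1)) x
    rw [mul_one, TensorProduct.rid_tmul, one_smul]

theorem pair₂_comul (f : FiniteDual k H) (x y : H) :
    pair₂ k H (comul (R := k) f) (x ⊗ₜ y) = f (x * y) := by
  change pair₂ k H (comulLin f) (x ⊗ₜ y) = _
  rw [pair₂_comulLin]
  rfl

theorem counit_apply (f : FiniteDual k H) : counit (R := k) f = f 1 := rfl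

theorem one_apply (x : H) : (1 : FiniteDual k H) x = counit (R := k) x := rfl

theorem mul_apply (f g : FiniteDual k H) (x : H) :
    (f * g) x = pair₂ k H (f ⊗ₜ g) (comul (R := k) x) := by
  change LinearMap.mul' k k (TensorProduct.map f.1.ofConv g.1.ofConv (comul x)) = _
  generalize comul (R := k) x = t
  induction t using TensorProduct.induction_on with
  | zero => simp
  | add a b ha hb => simp only [map_add, ha, hb]
  | tmul a b => rfl

theorem pair₂_mul (s t : FiniteDual k H ⊗[k] FiniteDual k H) (x y : H) {ι κ : Type*}
    (rx : Repr k x ι) (ry : Repr k y κ) :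
    pair₂ k H (s * t) (x ⊗ₜ y) = ∑ i ∈ rx.index, ∑ j ∈ ry.index,
      pair₂ k H s (rx.left i ⊗ₜ ry.left j) * pair₂ k H t (rx.right i ⊗ₜ ry.right j) := by
  induction s using TensorProduct.induction_on with
  | zero => simp
  | add a b ha hb =>
    simp only [add_mul, map_add, LinearMap.add_apply, ha, hb, Finset.sum_add_distrib]
  | tmul a b =>
    induction t using TensorProduct.induction_on with
    | zero => simp
    | add c d hc hd =>
      simp only [mul_add, map_add, LinearMap.add_apply, hc, hd, Finset.sum_add_distrib]
    | tmul c d =>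
      rw [Algebra.TensorProduct.tmul_mul_tmul, pair₂_tmul, mul_apply, mul_apply, ← rx.eq, ← ry.eq]
      simp only [map_sum, pair₂_tmul, Finset.sum_mul_sum]
      exact Finset.sum_congr rfl fun i _ => Finset.sum_congr rfl fun j _ => by ring

noncomputable instance : Bialgebra k (FiniteDual k H) :=
  Bialgebra.mk' k (FiniteDual k H)
    (by rw [counit_apply, one_apply, Bialgebra.counit_one])
    (by
      intro f g
      rw [counit_apply, mul_apply, Bialgebra.comul_one, Algebra.TensorProduct.one_def, pair₂_tmul]
      rfl)
    (by
      apply ext₂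
      intro x y
      rw [pair₂_comul, one_apply, Bialgebra.counit_mul, Algebra.TensorProduct.one_def, pair₂_tmul]
      rfl)
    (by
      intro f g
      apply ext₂
      intro x y
      rw [pair₂_comul, mul_apply, Bialgebra.comul_mul, pair₂_mul _ _ _ _ (ℛ k x) (ℛ k y)]
      conv_lhs => rw [← (ℛ k x).eq, ← (ℛ k y).eq]
      simp only [Finset.sum_mul_sum, Algebra.TensorProduct.tmul_mul_tmul, map_sum, pair₂_tmul,
        pair₂_comul])

theorem isRepresentative_antipode {f : H →ₗ[k] k} (hf : IsRepresentative f) :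
    IsRepresentative (f ∘ₗ antipode k) := by
  obtain ⟨J, _, _, g, rfl⟩ := hf.exists_algHom
  have : Module.Finite k (H ⧸ J)ᵐᵒᵖ := Module.Finite.equiv (MulOpposite.opLinearEquiv k)
  refine isRepresentative_of_algHom
    ((AlgHom.op (Ideal.Quotient.mkₐ k J)).comp (antipodeAlgHomOp k H)) _ fun x hx => ?_
  have h1 : Ideal.Quotient.mkₐ k J (antipode k x) = 0 := congrArg MulOpposite.unop hx
  simp only [LinearMap.comp_apply, AlgHom.toLinearMap_apply, h1, map_zero]

/-- The antipode of the Hopf dual: `f ↦ f ∘ S`. -/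
def antipodeLin : FiniteDual k H →ₗ[k] FiniteDual k H where
  toFun f := mk (f.1.ofConv ∘ₗ antipode k) (isRepresentative_antipode f.2)
  map_add' _ _ := rfl
  map_smul' _ _ := rfl

noncomputable instance : HopfAlgebra k (FiniteDual k H) where
  antipode := antipodeLin
  mul_antipode_rTensor_comul := by
    ext f
    apply ext
    intro x
    have h1 : ∀ t : FiniteDual k H ⊗[k] FiniteDual k H,
        (LinearMap.mul' k (FiniteDual k H) (antipodeLin.rTensor _ t)) x =
          pair₂ k H t ((antipode k).rTensor H (comul (R := k) x)) := fun t => by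
      induction t using TensorProduct.induction_on with
      | zero => simp; rfl
      | add a b ha hb => simp only [map_add, LinearMap.add_apply, ← ha, ← hb]; rfl
      | tmul a b =>
        rw [LinearMap.rTensor_tmul, LinearMap.mul'_apply, mul_apply]
        generalize comul (R := k) x = u
        induction u using TensorProduct.induction_on with
        | zero => simp
        | add a b ha hb => simp only [map_add, ha, hb]
        | tmul u v => rfl
    refine (h1 _).trans ?_
    refine (LinearMap.congr_fun (pair₂_comulLin f) _).trans ?_
    rw [LinearMap.comp_apply, mul_antipode_rTensor_comul_apply]
    change f (algebraMap k H (counit x)) = f 1 * counit x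
    rw [Algebra.algebraMap_eq_smul_one]
    exact (map_smul (toDual k H f) _ _).trans (mul_comm _ _)
  mul_antipode_lTensor_comul := by
    ext f
    apply ext
    intro x
    have h1 : ∀ t : FiniteDual k H ⊗[k] FiniteDual k H,
        (LinearMap.mul' k (FiniteDual k H) (antipodeLin.lTensor _ t)) x =
          pair₂ k H t ((antipode k).lTensor H (comul (R := k) x)) := fun t => by
      induction t using TensorProduct.induction_on with
      | zero => simp; rfl
      | add a b ha hb => simp only [map_add, LinearMap.add_apply, ← ha, ← hb]; rfl
      | tmul a b =>
        rw [LinearMap.lTensor_tmul, LinearMap.mul'_apply, mul_apply]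
        generalize comul (R := k) x = u
        induction u using TensorProduct.induction_on with
        | zero => simp
        | add a b ha hb => simp only [map_add, ha, hb]
        | tmul u v => rfl
    refine (h1 _).trans ?_
    refine (LinearMap.congr_fun (pair₂_comulLin f) _).trans ?_
    rw [LinearMap.comp_apply, mul_antipode_lTensor_comul_apply]
    change f (algebraMap k H (counit x)) = f 1 * counit x
    rw [Algebra.algebraMap_eq_smul_one]
    exact (map_smul (toDual k H f) _ _).trans (mul_comm _ _)

theorem antipode_apply (f : FiniteDual k H) (x : H) :
    (antipode k f : FiniteDual k H) x = f (antipode k x) := rfl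

end FiniteDual

end FiniteDual

section HSigma

variable {k B : Type*} [Field k] [Ring B] [Algebra k B] {n : ℕ}
  {σ : Matrix (Fin n) (Fin n) (Module.End k B)}

/-- The action of the free Hopf algebra on `B`, `s d i j ↦ σ_d i j`. -/
noncomputable def freeRep (hσ : IsQuantumAut σ) : FreeHopf k n →ₐ[k] Module.End k B :=
  FreeHopf.lift (fun d i j => hσ.stronglyInvertible.seq d i j)
    (fun d i j => by
      have := congrFun (congrFun (hσ.stronglyInvertible.seq_spec.2 d).1 i) j
      simpa [Matrix.mul_apply, Matrix.one_apply] using this)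
    (fun d i j => by
      have := congrFun (congrFun (hσ.stronglyInvertible.seq_spec.2 d).2 i) j
      simpa [Matrix.mul_apply, Matrix.one_apply] using this)

/-- The Hopf algebra `H_σ`: the Hopf image of the action of the free Hopf algebra on `B`. -/
def HSigma (hσ : IsQuantumAut σ) : Type _ := HopfImage (freeRep hσ)

namespace HSigma

variable (hσ : IsQuantumAut σ)

noncomputable instance : Ring (HSigma hσ) := inferInstanceAs (Ring (HopfImage (freeRep hσ)))

noncomputable instance : HopfAlgebra k (HSigma hσ) :=
  inferInstanceAs (HopfAlgebra k (HopfImage (freeRep hσ)))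

/-- The class `[s d i j]` in `H_σ`. -/
noncomputable def s (d : ℤ) (i j : Fin n) : HSigma hσ :=
  Ideal.Quotient.mk (hopfCore (freeRep hσ)) (FreeHopf.s d i j)

/-- The action of `H_σ` on `B`. -/
noncomputable def act : HSigma hσ →ₐ[k] Module.End k B := hopfImageRep (freeRep hσ)

theorem act_s (d : ℤ) (i j : Fin n) :
    act hσ (s hσ d i j) = hσ.stronglyInvertible.seq d i j := by
  change freeRep hσ (FreeHopf.s d i j) = _
  exact FreeHopf.lift_s _ _ _ d i j

theorem act_s_zero (i j : Fin n) : act hσ (s hσ 0 i j) = σ i j := by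
  rw [act_s, hσ.stronglyInvertible.seq_spec.1]

end HSigma

/-- The matrix coefficients `X ↦ f (X ▷ b)`, for `b : B` and `f` in the dual of `B`, of the
`H_σ`-action on `B`, as elements of `H_σ°`. (If `σ` is locally finite, then all these functionals
lie in `H_σ°`.) -/
def matrixCoeffs (hσ : IsQuantumAut σ) : Set (FiniteDual k (HSigma hσ)) :=
  {a | ∃ (b : B) (f : Module.Dual k B), ∀ X, a X = f (HSigma.act hσ X b)}

/-- The Hopf algebra `A_σ`: the Hopf subalgebra of `H_σ°` generated by the matrix coefficients
of the action on `B`. -/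
def ASigma (hσ : IsQuantumAut σ) : Type _ := hopfClosure (k := k) (matrixCoeffs hσ)

namespace ASigma

variable (hσ : IsQuantumAut σ)

noncomputable instance : Ring (ASigma hσ) :=
  inferInstanceAs (Ring (hopfClosure (k := k) (matrixCoeffs hσ)))

noncomputable instance : HopfAlgebra k (ASigma hσ) :=
  inferInstanceAs (HopfAlgebra k (hopfClosure (k := k) (matrixCoeffs hσ)))

/-- The inclusion `A_σ ⊆ H_σ°`. -/
noncomputable def incl : ASigma hσ →ₐ[k] FiniteDual k (HSigma hσ) :=
  (hopfClosure (k := k) (matrixCoeffs hσ)).val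

variable {hσ} in
/-- Elements of `A_σ` are functionals on `H_σ`. -/
noncomputable def eval (a : ASigma hσ) (X : HSigma hσ) : k := incl hσ a X

noncomputable instance : CoeFun (ASigma hσ) fun _ => HSigma hσ → k := ⟨eval⟩

theorem incl_injective : Function.Injective (incl hσ) := Subtype.val_injective

theorem map_incl_comul (a : ASigma hσ) :
    TensorProduct.map (incl hσ).toLinearMap (incl hσ).toLinearMap (comul (R := k) a) =
      comul (R := k) (incl hσ a) :=
  IsHopfSubalgebra.map_val_comul (hopfClosure (k := k) (matrixCoeffs hσ)) a

theorem counit_incl (a : ASigma hσ) : counit (R := k) (incl hσ a) = counit (R := k) a := rfl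

theorem incl_antipode (a : ASigma hσ) :
    incl hσ (antipode k a) = antipode k (incl hσ a) := rfl

end ASigma

end HSigma

section Cusp

variable (k : Type*) [Field k]

/-- The coordinate ring `k[t², t³]` of the cusp. -/
noncomputable abbrev Cusp : Subalgebra k k[X] :=
  Algebra.adjoin k {Polynomial.X ^ 2, Polynomial.X ^ 3}

namespace Cusp

/-- The element `t²`. -/
noncomputable def x : Cusp k := ⟨Polynomial.X ^ 2, Algebra.subset_adjoin (by simp)⟩

/-- The element `t³`. -/
noncomputable def y : Cusp k := ⟨Polynomial.X ^ 3, Algebra.subset_adjoin (by simp)⟩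

variable {k}

/-- The matrix `σ(t)` over the Laurent polynomials, for a given square root `i` of `-1`. -/
noncomputable def matT (i : k) : Matrix (Fin 3) (Fin 3) k[T;T⁻¹] :=
  open LaurentPolynomial in
  !![T 1, T 1 - C i, -(C (1 / 3) * T (-1)) - C (1 / 2) * T 1;
     0, -T 1, T 1 + C i;
     0, 0, T 1]

/-- The algebra morphism from `k[t]` to matrices of Laurent polynomials with `t ↦ matT i`. -/
noncomputable def evalT (i : k) : k[X] →ₐ[k] Matrix (Fin 3) (Fin 3) k[T;T⁻¹] :=
  Polynomial.aeval (matT i)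

/-- `k[t², t³]` inside the Laurent polynomials. -/
noncomputable def laurentCusp (k : Type*) [Field k] : Subalgebra k k[T;T⁻¹] :=
  (Cusp k).map Polynomial.toLaurentAlg

/-- The identification of `k[t², t³]` with its image in the Laurent polynomials. -/
noncomputable def equivLaurent (k : Type*) [Field k] : Cusp k ≃ₐ[k] laurentCusp k :=
  (Cusp k).equivMapOfInjective Polynomial.toLaurentAlg Polynomial.toLaurent_injective

theorem coe_equivLaurent (b : Cusp k) :
    (equivLaurent k b : k[T;T⁻¹]) = Polynomial.toLaurent (b : k[X]) := rfl

theorem T2_mem : (LaurentPolynomial.T 2 : k[T;T⁻¹]) ∈ laurentCusp k :=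
  ⟨x k, (x k).2, Polynomial.toLaurent_X_pow 2⟩

theorem T3_mem : (LaurentPolynomial.T 3 : k[T;T⁻¹]) ∈ laurentCusp k :=
  ⟨y k, (y k).2, Polynomial.toLaurent_X_pow 3⟩

theorem C_mem (c : k) : (LaurentPolynomial.C c : k[T;T⁻¹]) ∈ laurentCusp k :=
  (laurentCusp k).algebraMap_mem c

theorem matT_sq [NeZero (2 : k)] [NeZero (3 : k)] {i : k} (hi : i ^ 2 = -1) :
    matT i ^ 2 = open LaurentPolynomial in
      !![T 2, 0, C (1 / 3); 0, T 2, 0; 0, 0, T 2] := by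
  have h2 : (2 : k) ≠ 0 := NeZero.ne _
  have h3 : (3 : k) ≠ 0 := NeZero.ne _
  have hT : (LaurentPolynomial.T 1 * LaurentPolynomial.T (-1) : k[T;T⁻¹]) = 1 := by
    rw [← LaurentPolynomial.T_add]; simp
  have hC2 : (LaurentPolynomial.C (1 / 2) : k[T;T⁻¹]) * 2 = 1 := by
    rw [show (2 : k[T;T⁻¹]) = LaurentPolynomial.C 2 from (map_ofNat _ 2).symm, ← map_mul]
    simp [h2]
  have hC3 : (LaurentPolynomial.C (1 / 3) : k[T;T⁻¹]) * 3 = 1 := by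
    rw [show (3 : k[T;T⁻¹]) = LaurentPolynomial.C 3 from (map_ofNat _ 3).symm, ← map_mul]
    simp [h3]
  have hCi : (LaurentPolynomial.C i : k[T;T⁻¹]) ^ 2 = -1 := by
    rw [← map_pow, hi]; simp
  have hT2 : (LaurentPolynomial.T 2 : k[T;T⁻¹]) = LaurentPolynomial.T 1 ^ 2 := by
    rw [LaurentPolynomial.T_pow]; rfl
  rw [hT2]
  simp only [matT]
  generalize (LaurentPolynomial.T 1 : k[T;T⁻¹]) = u at *
  generalize (LaurentPolynomial.T (-1) : k[T;T⁻¹]) = v at *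
  generalize (LaurentPolynomial.C (1 / 2) : k[T;T⁻¹]) = c at *
  generalize (LaurentPolynomial.C (1 / 3) : k[T;T⁻¹]) = e at *
  generalize (LaurentPolynomial.C i : k[T;T⁻¹]) = j at *
  ext a b : 1
  fin_cases a <;> fin_cases b <;>
    simp [pow_two, Matrix.mul_apply, Fin.sum_univ_three]
  · ring
  · linear_combination (-2 * e) * hT - u ^ 2 * hC2 - hCi - hC3
  · ring

theorem matT_cube [NeZero (2 : k)] [NeZero (3 : k)] {i : k} (hi : i ^ 2 = -1) :
    matT i ^ 3 = open LaurentPolynomial in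
      !![T 3, T 3 - C i * T 2, -(C (1 / 2) * T 3);
         0, -T 3, T 3 + C i * T 2;
         0, 0, T 3] := by
  have hT : (LaurentPolynomial.T 2 * LaurentPolynomial.T (-1) : k[T;T⁻¹]) =
      LaurentPolynomial.T 1 := by
    rw [← LaurentPolynomial.T_add]; rfl
  have hT3 : (LaurentPolynomial.T 3 : k[T;T⁻¹]) =
      LaurentPolynomial.T 2 * LaurentPolynomial.T 1 := by
    rw [← LaurentPolynomial.T_add]; rfl
  rw [pow_succ, matT_sq hi, hT3, matT]
  generalize (LaurentPolynomial.T 1 : k[T;T⁻¹]) = u at *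
  generalize (LaurentPolynomial.T 2 : k[T;T⁻¹]) = w at *
  generalize (LaurentPolynomial.T (-1) : k[T;T⁻¹]) = v at *
  generalize (LaurentPolynomial.C (1 / 2) : k[T;T⁻¹]) = c at *
  generalize (LaurentPolynomial.C (1 / 3) : k[T;T⁻¹]) = e at *
  generalize (LaurentPolynomial.C i : k[T;T⁻¹]) = j at *
  ext a b : 1
  fin_cases a <;> fin_cases b <;>
    simp [Matrix.mul_apply, Fin.sum_univ_three]
  · ring
  · linear_combination (-e) * hT
  · ring

theorem evalT_mem [NeZero (2 : k)] [NeZero (3 : k)] {i : k} (hi : i ^ 2 = -1) (b : Cusp k)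
    (r s : Fin 3) : evalT i b r s ∈ laurentCusp k := by
  obtain ⟨b, hb⟩ := b
  revert r s
  induction hb using Algebra.adjoin_induction with
  | mem p hp =>
    have h2 := T2_mem (k := k)
    have h3 := T3_mem (k := k)
    rcases hp with rfl | rfl
    · intro r s
      simp only [evalT, map_pow, Polynomial.aeval_X, matT_sq hi]
      fin_cases r <;> fin_cases s <;> simp [h2, C_mem, -one_div]
    · intro r s
      simp only [evalT, map_pow, Polynomial.aeval_X, matT_cube hi]
      fin_cases r <;> fin_cases s
      · simpa using h3
      · simpa using sub_mem h3 (mul_mem (C_mem i) h2)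
      · simpa [-one_div] using mul_mem (C_mem (1 / 2)) h3
      · simp
      · simpa using h3
      · simpa using add_mem h3 (mul_mem (C_mem i) h2)
      · simp
      · simp
      · simpa using h3
  | algebraMap c =>
    intro r s
    simp only [AlgHom.commutes, Matrix.algebraMap_matrix_apply]
    split_ifs
    · exact (laurentCusp k).algebraMap_mem c
    · exact zero_mem _
  | add p q _ _ hp hq =>
    intro r s
    simp only [map_add, Matrix.add_apply]
    exact add_mem (hp r s) (hq r s)
  | mul p q _ _ hp hq =>
    intro r s
    simp only [map_mul, Matrix.mul_apply]
    exact sum_mem fun l _ => mul_mem (hp r l) (hq l s)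

theorem evalT_shape (i : k) (p : k[X]) :
    evalT i p 1 0 = 0 ∧ evalT i p 2 0 = 0 ∧ evalT i p 2 1 = 0 ∧
      evalT i p 0 0 = Polynomial.toLaurent p ∧
      evalT i p 1 1 = Polynomial.toLaurent (p.comp (-Polynomial.X)) ∧
      evalT i p 2 2 = Polynomial.toLaurent p := by
  induction p using Polynomial.induction_on' with
  | add p q hp hq => simp [hp, hq]
  | monomial n a =>
    induction n with
    | zero => simp [evalT, LaurentPolynomial.algebraMap_apply, Matrix.algebraMap_matrix_apply]
    | succ n ih =>
      rw [← Polynomial.monomial_mul_X, map_mul]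
      have hX : evalT i Polynomial.X = matT i := Polynomial.aeval_X _
      obtain ⟨h1, h2, h3, h4, h5, h6⟩ := ih
      simp [hX, Matrix.mul_apply, Fin.sum_univ_three, h1, h2, h3, h4, h5, h6, matT]
      ring

variable [NeZero (2 : k)] [NeZero (3 : k)] {i : k} (hi : i ^ 2 = -1)

/-- The matrix `σ` of endomorphisms of `k[t², t³]`: `σ r s b` is the `(r, s)` entry of `b(T)`,
where `T = matT i`. -/
noncomputable def sigma : Matrix (Fin 3) (Fin 3) (Module.End k (Cusp k)) := fun r s =>
  (equivLaurent k).symm.toLinearMap ∘ₗ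
    LinearMap.codRestrict (Subalgebra.toSubmodule (laurentCusp k))
      (Matrix.entryLinearMap k k[T;T⁻¹] r s ∘ₗ (evalT i).toLinearMap ∘ₗ (Cusp k).val.toLinearMap)
      (fun b => evalT_mem hi b r s)

theorem toLaurent_sigma (r s : Fin 3) (b : Cusp k) :
    Polynomial.toLaurent (sigma hi r s b : k[X]) = evalT i b r s := by
  rw [← coe_equivLaurent]
  exact congrArg Subtype.val ((equivLaurent k).apply_symm_apply ⟨evalT i b r s, evalT_mem hi b r s⟩)

theorem sigma_eq_iff (r s : Fin 3) (b c : Cusp k) :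
    sigma hi r s b = c ↔ evalT i b r s = Polynomial.toLaurent (c : k[X]) := by
  rw [← toLaurent_sigma hi, Polynomial.toLaurent_inj, Subtype.ext_iff]

theorem sigma_shape : sigma hi = upperTri (sigma hi 1 1)
    (sigma hi 0 1, sigma hi 1 2, sigma hi 0 2) := by
  ext r s b : 3
  obtain ⟨h1, h2, h3, h4, h5, h6⟩ := evalT_shape i (b : k[X])
  fin_cases r <;> fin_cases s <;> simp [upperTri, sigma_eq_iff, h1, h2, h3, h4, h6]

theorem sigma_mid_sq : sigma hi 1 1 * sigma hi 1 1 = 1 := by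
  have h : ∀ b : Cusp k, (sigma hi 1 1 b : k[X]) = (b : k[X]).comp (-Polynomial.X) := fun b => by
    rw [← Polynomial.toLaurent_inj, toLaurent_sigma]
    exact (evalT_shape i (b : k[X])).2.2.2.2.1
  ext b : 2
  rw [Module.End.mul_apply, Module.End.one_apply, h, h, Polynomial.comp_assoc]
  simp

theorem isQuantumAut_sigma : IsQuantumAut (sigma hi) where
  stronglyInvertible := by
    rw [sigma_shape]
    exact upperTri_stronglyInvertible _ (sigma_mid_sq hi) _
  map_one r s := by
    rw [sigma_eq_iff]
    simp only [OneMemClass.coe_one, map_one, Matrix.one_apply]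
    split_ifs <;> simp
  map_mul r s a b := by
    rw [sigma_eq_iff]
    simp [Matrix.mul_apply, toLaurent_sigma]

/-- `σ` on the generators `t²` and `t³`. -/
theorem sigma_x (r s : Fin 3) : Polynomial.toLaurent (sigma hi r s (x k) : k[X]) =
    (open LaurentPolynomial in !![T 2, 0, C (1 / 3); 0, T 2, 0; 0, 0, T 2] :
      Matrix (Fin 3) (Fin 3) k[T;T⁻¹]) r s := by
  rw [toLaurent_sigma, ← matT_sq hi]
  simp [x, evalT]

theorem sigma_y (r s : Fin 3) : Polynomial.toLaurent (sigma hi r s (y k) : k[X]) =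
    (open LaurentPolynomial in !![T 3, T 3 - C i * T 2, -(C (1 / 2) * T 3);
       0, -T 3, T 3 + C i * T 2; 0, 0, T 3] : Matrix (Fin 3) (Fin 3) k[T;T⁻¹]) r s := by
  rw [toLaurent_sigma, ← matT_cube hi]
  simp [y, evalT]

end Cusp

namespace Cusp

variable {k} [NeZero (2 : k)] [NeZero (3 : k)] {i : k} (hi : i ^ 2 = -1)

/-- The Hopf algebra `H_σ` of the cusp. -/
abbrev H : Type _ := HSigma (isQuantumAut_sigma hi)

/-- The Hopf algebra `A_σ` of the cusp. -/
abbrev A : Type _ := ASigma (isQuantumAut_sigma hi)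

/-- The basis `1, t², t³` of the submodule `F₃` of `k[t², t³]`. -/
noncomputable def e (k : Type*) [Field k] : Fin 3 → Cusp k := ![1, x k, y k]

theorem linearIndependent_e (k : Type*) [Field k] : LinearIndependent k (e k) := by
  rw [Fintype.linearIndependent_iff]
  intro g hg
  have h : Polynomial.C (g 0) + Polynomial.C (g 1) * Polynomial.X ^ 2 +
      Polynomial.C (g 2) * Polynomial.X ^ 3 = (0 : k[X]) := by
    have := congrArg Subtype.val hg
    simpa [Fin.sum_univ_three, e, x, y, Polynomial.smul_eq_C_mul] using this
  have h0 := congrArg (Polynomial.coeff · 0) h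
  have h2 := congrArg (Polynomial.coeff · 2) h
  have h3 := congrArg (Polynomial.coeff · 3) h
  simp [Polynomial.coeff_X_pow, Polynomial.coeff_C] at h0 h2 h3
  intro j
  fin_cases j <;> simp [h0, h2, h3]

end Cusp

/-- The free algebra `k⟨γ, φ, ψ⟩`. -/
abbrev Free₃ : Type _ := FreeAlgebra k (Fin 3)

namespace Free₃

/-- The generator `γ`. -/
def γ : Free₃ k := FreeAlgebra.ι k 0

/-- The generator `φ`. -/
def φ : Free₃ k := FreeAlgebra.ι k 1

/-- The generator `ψ`. -/
def ψ : Free₃ k := FreeAlgebra.ι k 2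

/-- The relators. -/
def relators : Set (Free₃ k) :=
  {ψ k ^ 2 - 1, γ k * ψ k + ψ k * γ k, φ k * ψ k + ψ k * φ k,
    27 * γ k ^ 2 - φ k ^ 6, 3 * (γ k * φ k + φ k * γ k) - φ k ^ 4}

end Free₃

end Cusp

end QuantumCusp

open QuantumCusp

/-!
The matrix `σ` is upper triangular on `k[t², t³]` and preserves the span `F₃` of `1, t², t³`. An
algebra morphism on the free Hopf algebra is determined by its values at the generators `s 0 i j`
(`FreeHopf.algHom_ext_zero`), and therefore a linear map commuting with these generators is a
morphism of representations (`FreeHopf.intertwines_of_zero`). This one principle shows that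
`k[t², t³]` is a module algebra over `H_σ` (`HSigma.act_mul`) and that `F₃` is a submodule on which
`H_σ` acts by upper triangular matrices, the first two diagonal entries being the counit.

Dually, the functionals coact: `t² ↦ t² + a₁₂` and `t³ ↦ t³ ψ + t² φ + γ`, and the coaction is
multiplicative, with values in polynomials in `t` over the Hopf dual (`IsCoaction.mul`). Comparing
coefficients in the image of `(t³)² = (t²)³` gives all the relations (`coef_relations`), among them
`φ² = 3 a₁₂`. The coproduct is that of matrix coefficients, and the antipode follows from it. As
`t²` and `t³` generate the algebra, all matrix coefficients are polynomials in `γ, φ, ψ`, and these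
polynomials form a Hopf subalgebra, whence surjectivity.

For the kernel in characteristic `0`: modulo the relations, every element of the free algebra has
the form `h₀ + φ h₁ + γ h₂ + φ γ h₃` with `hⱼ = uⱼ(φ²) + vⱼ(φ²) ψ` (`exists_normalForm`). If this
element vanishes as a functional, then so do its right translates by the entries of the matrix
`s 0`. Since that matrix is comultiplicative, translation is an algebra morphism to `3 × 3` matrices
and is computed on generators (`translate_apply`). After a change of basis diagonalizing `ψ`, the
corner entry differentiates the polynomials `uⱼ, vⱼ`, and the entry next to the diagonal is a skew
derivation with `φ ↦ 1`, `γ ↦ φ² / 3`, `ψ ↦ 0` (`translateDiag_normalForm`). Characteristic `0` is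
used exactly in that a polynomial with vanishing derivative is constant; repeated differentiation
forces all the coefficients to vanish (`normalForm_injective`).
-/

namespace QuantumCusp

/-! ### Representations of the free Hopf algebra -/

namespace FreeHopf

variable {k : Type*} [CommRing k] {n : ℕ}

/-- The values at all generators `s d i j` are determined by those with `d = 0`, because a
contragredient sequence is determined by its zeroth term. -/
theorem algHom_ext_zero {E : Type*} [Ring E] [Algebra k E] {f g : FreeHopf k n →ₐ[k] E}
    (h : ∀ i j, f (s 0 i j) = g (s 0 i j)) : f = g := by
  have key : ∀ f : FreeHopf k n →ₐ[k] E, IsContragredientSeq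
      (Matrix.of fun i j => f (s 0 i j)) (fun d => Matrix.of fun i j => f (s d i j)) := by
    refine fun f => ⟨rfl, fun d => ⟨?_, ?_⟩⟩
    · ext i j
      simp [Matrix.mul_apply, Matrix.one_apply, ← map_mul, ← map_sum, row, apply_ite f]
    · ext i j
      simp [Matrix.mul_apply, Matrix.one_apply, ← map_mul, ← map_sum, col, apply_ite f]
  have hf := key f
  have h0 : (Matrix.of fun i j => f (s 0 i j)) = Matrix.of fun i j => g (s 0 i j) := by
    ext i j
    exact h i j
  rw [h0] at hf
  refine algHom_ext fun d i j => ?_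
  exact congrFun (congrFun (congrFun (hf.unique (key g)) d) i) j

/-- A linear map that commutes with the generators `s 0 i j` is a morphism of representations:
conjugating `ρ ⊕ ρ'` by the unipotent automorphism `(v, w) ↦ (v, w + f v)` does not change the
values at these generators, so it changes nothing. -/
theorem intertwines_of_zero {V W : Type*} [AddCommGroup V] [Module k V] [AddCommGroup W]
    [Module k W] (ρ : FreeHopf k n →ₐ[k] Module.End k V) (ρ' : FreeHopf k n →ₐ[k] Module.End k W)
    (f : V →ₗ[k] W) (h : ∀ i j v, f (ρ (s 0 i j) v) = ρ' (s 0 i j) (f v)) (X : FreeHopf k n)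
    (v : V) : f (ρ X v) = ρ' X (f v) := by
  let u : (V × W) ≃ₗ[k] (V × W) :=
    LinearEquiv.skewProd (LinearEquiv.refl k V) (LinearEquiv.refl k W) f
  let D : FreeHopf k n →ₐ[k] Module.End k (V × W) :=
    (LinearMap.prodMapAlgHom k V W).comp (ρ.prod ρ')
  have hD : ((u.conjAlgEquiv k : Module.End k (V × W) →ₐ[k] Module.End k (V × W))).comp D = D := by
    refine algHom_ext_zero fun i j => LinearMap.ext fun p => ?_
    simp [D, u, LinearEquiv.conjAlgEquiv_apply, h]
  have := congrArg Prod.snd (LinearMap.congr_fun (AlgHom.congr_fun hD X) (v, 0))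
  simp only [D, u, AlgHom.comp_apply] at this
  simpa [LinearEquiv.conjAlgEquiv_apply, add_comm, add_neg_eq_zero] using this

end FreeHopf

/-! ### The action of `H_σ` on `B` -/

namespace HSigma

variable {k B : Type*} [Field k] [Ring B] [Algebra k B] {n : ℕ}
  {σ : Matrix (Fin n) (Fin n) (Module.End k B)} (hσ : IsQuantumAut σ)

/-- The quotient map from the free Hopf algebra to `H_σ`. -/
noncomputable def mk : FreeHopf k n →ₐc[k] HSigma hσ :=
  Bialgebra.Quotient.mkBialgHom (hopfCore (freeRep hσ))

theorem mk_surjective : Function.Surjective (mk hσ) := Ideal.Quotient.mk_surjective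

theorem mk_s (d : ℤ) (i j : Fin n) : mk hσ (FreeHopf.s d i j) = s hσ d i j := rfl

/-- An algebra morphism on the free Hopf algebra that vanishes wherever the action on `B` does
factors through `H_σ`. -/
noncomputable def lift {E : Type*} [Ring E] [Algebra k E] (f : FreeHopf k n →ₐ[k] E)
    (hf : ∀ X, freeRep hσ X = 0 → f X = 0) : HSigma hσ →ₐ[k] E :=
  Ideal.Quotient.liftₐ (hopfCore (freeRep hσ)) f fun X hX => hf X <|
    hopfCore_induction _ (C := fun x => freeRep hσ x = 0) (map_zero _)
      (fun x y hx hy => by rw [map_add, hx, hy, add_zero]) (fun _ hI => hI.2.2) hX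

theorem lift_mk {E : Type*} [Ring E] [Algebra k E] (f : FreeHopf k n →ₐ[k] E)
    (hf : ∀ X, freeRep hσ X = 0 → f X = 0) (X : FreeHopf k n) : lift hσ f hf (mk hσ X) = f X := rfl

theorem comul_s (d : ℤ) (i j : Fin n) :
    comul (R := k) (s hσ d i j) = ∑ r, s hσ d i r ⊗ₜ[k] s hσ d r j := by
  rw [← mk_s, ← CoalgHomClass.map_comp_comul_apply, FreeHopf.comul_s]
  simp [mk_s]

theorem counit_s (d : ℤ) (i j : Fin n) :
    counit (R := k) (s hσ d i j) = if i = j then 1 else 0 := by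
  rw [← mk_s, CoalgHomClass.counit_comp_apply, FreeHopf.counit_s]

theorem act_one (X : HSigma hσ) : act hσ X 1 = counit (R := k) X • 1 := by
  obtain ⟨X, rfl⟩ := mk_surjective hσ X
  have h := FreeHopf.intertwines_of_zero ((Algebra.lmul k k).comp (Bialgebra.counitAlgHom k _))
    ((act hσ).comp (mk hσ : FreeHopf k n →ₐ[k] HSigma hσ)) (Algebra.linearMap k B)
    (fun i j c => by
      simp [FreeHopf.counit_s, mk_s, act_s_zero, Algebra.algebraMap_eq_smul_one, hσ.map_one,
        Matrix.one_apply]) X 1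
  simp only [AlgHom.comp_apply, Bialgebra.counitAlgHom_apply, Algebra.linearMap_apply, map_one] at h
  refine h.symm.trans ?_
  rw [CoalgHomClass.counit_comp_apply]
  simp [Algebra.algebraMap_eq_smul_one]

/-- `B` is an `H_σ`-module algebra. -/
theorem act_mul (X : HSigma hσ) {ι : Type*} (r : Repr k X ι) (b c : B) :
    act hσ X (b * c) = ∑ j ∈ r.index, act hσ (r.left j) b * act hσ (r.right j) c := by
  let T : HSigma hσ →ₐ[k] Module.End k (B ⊗[k] B) := (Module.endTensorEndAlgHom (R := k) (S := k)
    (A := k)).comp ((Algebra.TensorProduct.map (act hσ) (act hσ)).comp (Bialgebra.comulAlgHom k _))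
  have key : ∀ X t, LinearMap.mul' k B (T X t) = act hσ X (LinearMap.mul' k B t) := by
    intro X t
    obtain ⟨X, rfl⟩ := mk_surjective hσ X
    refine FreeHopf.intertwines_of_zero (T.comp (mk hσ : FreeHopf k n →ₐ[k] HSigma hσ))
      ((act hσ).comp (mk hσ : FreeHopf k n →ₐ[k] HSigma hσ)) (LinearMap.mul' k B) ?_ X t
    intro i j t
    induction t using TensorProduct.induction_on with
    | zero => simp
    | add x y hx hy => simp only [map_add, hx, hy]
    | tmul x y =>
      change LinearMap.mul' k B (T (s hσ 0 i j) (x ⊗ₜ y)) = act hσ (s hσ 0 i j) (x * y)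
      simp only [T, AlgHom.comp_apply, Bialgebra.comulAlgHom_apply, comul_s,
        map_sum, Algebra.TensorProduct.map_tmul, act_s_zero, LinearMap.sum_apply, hσ.map_mul]
      rfl
  have := (key X (b ⊗ₜ c)).symm
  simp only [T, AlgHom.comp_apply, Bialgebra.comulAlgHom_apply, ← r.eq, LinearMap.mul'_apply,
    map_sum, Algebra.TensorProduct.map_tmul, LinearMap.sum_apply] at this
  exact this

end HSigma

/-- The algebra morphism `s d i j ↦ σ_d i j` defined by a strongly invertible matrix `σ`. -/
noncomputable def StronglyInvertible.hom {k P : Type*} [CommRing k] [Ring P] [Algebra k P] {n : ℕ}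
    {σ : Matrix (Fin n) (Fin n) P} (h : StronglyInvertible σ) : FreeHopf k n →ₐ[k] P :=
  FreeHopf.lift (fun d i j => h.seq d i j)
    (fun d i j => by
      simpa [Matrix.mul_apply, Matrix.one_apply] using
        congrFun (congrFun (h.seq_spec.2 d).1 i) j)
    (fun d i j => by
      simpa [Matrix.mul_apply, Matrix.one_apply] using
        congrFun (congrFun (h.seq_spec.2 d).2 i) j)

theorem StronglyInvertible.hom_s_zero {k P : Type*} [CommRing k] [Ring P] [Algebra k P] {n : ℕ}
    {σ : Matrix (Fin n) (Fin n) P} (h : StronglyInvertible σ) (i j : Fin n) :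
    h.hom (FreeHopf.s 0 i j : FreeHopf k n) = σ i j :=
  (FreeHopf.lift_s _ _ _ 0 i j).trans (by rw [h.seq_spec.1])

namespace Cusp

/-! ### The submodule spanned by `1, t², t³` -/

/-- The upper triangular `3 × 3` matrices whose first two diagonal entries agree. -/
def flagAlgebra (k : Type*) [Field k] : Subalgebra k (Matrix (Fin 3) (Fin 3) k) where
  carrier := {M | M 1 0 = 0 ∧ M 2 0 = 0 ∧ M 2 1 = 0 ∧ M 1 1 = M 0 0}
  mul_mem' := by
    rintro M N ⟨h1, h2, h3, h4⟩ ⟨h1', h2', h3', h4'⟩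
    simp [Matrix.mul_apply, Fin.sum_univ_three, h1, h2, h3, h4, h1', h2', h3', h4']
  add_mem' := by
    rintro M N ⟨h1, h2, h3, h4⟩ ⟨h1', h2', h3', h4'⟩
    simp [h1, h2, h3, h4, h1', h2', h3', h4']
  algebraMap_mem' r := by simp [Matrix.algebraMap_matrix_apply]

variable {k : Type*} [Field k]

/-- The diagonal entry `σ 1 1` on the span of `1, t², t³`. -/
def flagK : flagAlgebra k := ⟨!![1, 0, 0; 0, 1, 0; 0, 0, -1], by simp [flagAlgebra]⟩

/-- The entries of `σ` above the diagonal on the span of `1, t², t³`. -/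
def flagU (i : k) : flagAlgebra k × flagAlgebra k × flagAlgebra k :=
  (⟨!![0, 0, 0; 0, 0, -i; 0, 0, 1], by simp [flagAlgebra]⟩,
    ⟨!![0, 0, 0; 0, 0, i; 0, 0, 1], by simp [flagAlgebra]⟩,
    ⟨!![0, 1 / 3, 0; 0, 0, 0; 0, 0, -(1 / 2)], by simp [flagAlgebra]⟩)

/-- The matrix `σ` restricted to the span of `1, t², t³`. -/
def sigmaFlag (i : k) : Matrix (Fin 3) (Fin 3) (flagAlgebra k) := upperTri flagK (flagU i)

theorem sigmaFlag_stronglyInvertible (i : k) : StronglyInvertible (sigmaFlag i) := by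
  refine upperTri_stronglyInvertible _ (Subtype.ext ?_) _
  ext r s
  fin_cases r <;> fin_cases s <;> simp [flagK, Matrix.mul_apply, Fin.sum_univ_three]

variable [NeZero (2 : k)] [NeZero (3 : k)] {i : k} (hi : i ^ 2 = -1)

/-- `sigmaFlag` is indeed the matrix of `σ` on the span of `1, t², t³`. -/
theorem sigma_e (r s j : Fin 3) :
    sigma hi r s (e k j) = ∑ l, (sigmaFlag i r s).1 l j • e k l := by
  rw [← Subtype.coe_inj, ← Polynomial.toLaurent_inj]
  have h1 := (isQuantumAut_sigma hi).map_one r s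
  have h2 := sigma_x hi r s
  have h3 := sigma_y hi r s
  fin_cases j
  · fin_cases r <;> fin_cases s <;>
      simp_all [e, sigmaFlag, upperTri, flagK, flagU, Fin.sum_univ_three]
  · fin_cases r <;> fin_cases s <;>
      simp_all [e, sigmaFlag, upperTri, flagK, flagU, Fin.sum_univ_three, x,
        Polynomial.smul_eq_C_mul]
  · fin_cases r <;> fin_cases s <;>
      simp_all [e, sigmaFlag, upperTri, flagK, flagU, Fin.sum_univ_three, x, y,
        Polynomial.smul_eq_C_mul]
    all_goals ring

/-- The span of `1, t², t³` is a submodule, because its inclusion commutes with the generators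
`s 0 r s`. -/
theorem freeRep_e (X : FreeHopf k 3) (j : Fin 3) :
    freeRep (isQuantumAut_sigma hi) X (e k j) =
      ∑ l, ((sigmaFlag_stronglyInvertible i).hom X).1 l j • e k l := by
  have h := FreeHopf.intertwines_of_zero
    ((Matrix.toLinAlgEquiv' (R := k) (n := Fin 3) : _ →ₐ[k] _).comp
      ((flagAlgebra k).val.comp (sigmaFlag_stronglyInvertible i).hom))
    (freeRep (isQuantumAut_sigma hi)) (Fintype.linearCombination k (e k))
    (fun r s v => by
      have h0 : freeRep (isQuantumAut_sigma hi) (FreeHopf.s 0 r s) = sigma hi r s :=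
        HSigma.act_s_zero (isQuantumAut_sigma hi) r s
      simp only [AlgHom.comp_apply, StronglyInvertible.hom_s_zero, h0,
        Fintype.linearCombination_apply, map_sum, map_smul, sigma_e, Finset.smul_sum]
      rw [Finset.sum_comm]
      refine Finset.sum_congr rfl fun l _ => ?_
      simp [Matrix.toLinAlgEquiv'_apply, Matrix.mulVec, dotProduct, Finset.sum_smul, smul_smul,
        mul_comm]) X (Pi.single j 1)
  simpa [Fintype.linearCombination_apply, Matrix.toLinAlgEquiv'_apply] using h.symm

/-- The representation of `H_σ` on the span of `1, t², t³`, by matrices in this basis. -/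
noncomputable def rep : H hi →ₐ[k] Matrix (Fin 3) (Fin 3) k :=
  HSigma.lift (isQuantumAut_sigma hi)
    ((flagAlgebra k).val.comp (sigmaFlag_stronglyInvertible i).hom) fun X hX => by
      ext r j
      have := freeRep_e hi X j
      rw [hX, LinearMap.zero_apply] at this
      exact Fintype.linearIndependent_iff.1 (linearIndependent_e k) _ this.symm r

theorem rep_mk (X : FreeHopf k 3) : rep hi (HSigma.mk (isQuantumAut_sigma hi) X) =
    ((sigmaFlag_stronglyInvertible i).hom X).1 :=
  HSigma.lift_mk _ _ _ X

theorem rep_s_zero (r s : Fin 3) :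
    rep hi (HSigma.s (isQuantumAut_sigma hi) 0 r s) = (sigmaFlag i r s).1 := by
  rw [← HSigma.mk_s, rep_mk, StronglyInvertible.hom_s_zero]

theorem act_e (X : H hi) (j : Fin 3) :
    HSigma.act (isQuantumAut_sigma hi) X (e k j) = ∑ l, rep hi X l j • e k l := by
  obtain ⟨X, rfl⟩ := HSigma.mk_surjective _ X
  exact freeRep_e hi X j

theorem rep_mem (X : H hi) : rep hi X ∈ flagAlgebra k := by
  obtain ⟨X, rfl⟩ := HSigma.mk_surjective _ X
  exact ((sigmaFlag_stronglyInvertible i).hom X).2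

theorem rep_zero_zero (X : H hi) : rep hi X 0 0 = counit (R := k) X := by
  have h := HSigma.act_one (isQuantumAut_sigma hi) X
  have h' := act_e hi X 0
  obtain ⟨h1, h2, -, -⟩ := rep_mem hi X
  have e0 : e k 0 = 1 := rfl
  rw [e0, h, Fin.sum_univ_three, h1, h2, e0, zero_smul, zero_smul, add_zero, add_zero] at h'
  exact (smul_left_injective k one_ne_zero h').symm

/-! ### The matrix coefficients of the submodule -/

/-- The Hopf dual of `H_σ`. -/
abbrev D : Type _ := FiniteDual k (H hi)

/-- The matrix coefficients of the span of `1, t², t³`. -/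
noncomputable def coef (r s : Fin 3) : D hi :=
  FiniteDual.mk (Matrix.entryLinearMap k k r s ∘ₗ (rep hi).toLinearMap)
    (isRepresentative_comp (rep hi) _)

theorem coef_apply (r s : Fin 3) (X : H hi) : coef hi r s X = rep hi X r s := rfl

theorem coef_one_zero : coef hi 1 0 = 0 := FiniteDual.ext fun X => (rep_mem hi X).1

theorem coef_two_zero : coef hi 2 0 = 0 := FiniteDual.ext fun X => (rep_mem hi X).2.1

theorem coef_two_one : coef hi 2 1 = 0 := FiniteDual.ext fun X => (rep_mem hi X).2.2.1

theorem coef_zero_zero : coef hi 0 0 = 1 := FiniteDual.ext fun X => rep_zero_zero hi X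

theorem coef_one_one : coef hi 1 1 = 1 :=
  FiniteDual.ext fun X => (rep_mem hi X).2.2.2.trans (rep_zero_zero hi X)

theorem comul_coef (r s : Fin 3) :
    comul (R := k) (coef hi r s) = ∑ l, coef hi r l ⊗ₜ[k] coef hi l s := by
  apply FiniteDual.ext₂
  intro X Y
  rw [FiniteDual.pair₂_comul, coef_apply, map_mul, Matrix.mul_apply]
  simp [coef_apply]

theorem counit_coef (r s : Fin 3) : counit (R := k) (coef hi r s) = if r = s then 1 else 0 := by
  rw [FiniteDual.counit_apply, coef_apply, map_one, Matrix.one_apply]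

end Cusp

namespace FiniteDual

variable {k H : Type*} [Field k] [Ring H] [HopfAlgebra k H]

theorem zero_apply (X : H) : (0 : FiniteDual k H) X = 0 := rfl

theorem add_apply (f g : FiniteDual k H) (X : H) : (f + g) X = f X + g X := rfl

theorem smul_apply (c : k) (f : FiniteDual k H) (X : H) : (c • f) X = c * f X := rfl

theorem sum_apply {ι : Type*} (s : Finset ι) (f : ι → FiniteDual k H) (X : H) :
    (∑ j ∈ s, f j) X = ∑ j ∈ s, f j X :=
  (congrArg (· X) (map_sum (toDual k H) f s)).trans (LinearMap.sum_apply _ _ _)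

theorem mul_apply_repr (f g : FiniteDual k H) {X : H} {ι : Type*} (r : Repr k X ι) :
    (f * g) X = ∑ j ∈ r.index, f (r.left j) * g (r.right j) := by
  rw [mul_apply, ← r.eq]
  simp

end FiniteDual

namespace Cusp

variable {k : Type*} [Field k] [NeZero (2 : k)] [NeZero (3 : k)] {i : k} (hi : i ^ 2 = -1)

/-! ### The coaction of the Hopf dual on the cusp -/

/-- The polynomial `∑ n, pₙ tⁿ` with coefficients in the Hopf dual is the image of `b` under the
coaction: `X ▷ b = ∑ n, pₙ(X) tⁿ` for all `X`. -/
def IsCoaction (b : Cusp k) (p : (D hi)[X]) : Prop :=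
  ∀ (X : H hi) (n : ℕ),
    (HSigma.act (isQuantumAut_sigma hi) X b : k[X]).coeff n = p.coeff n X

variable {hi}

theorem IsCoaction.unique {b : Cusp k} {p q : (D hi)[X]} (hp : IsCoaction hi b p)
    (hq : IsCoaction hi b q) : p = q :=
  Polynomial.ext fun n => FiniteDual.ext fun X => (hp X n).symm.trans (hq X n)

theorem IsCoaction.add {b c : Cusp k} {p q : (D hi)[X]} (hp : IsCoaction hi b p)
    (hq : IsCoaction hi c q) : IsCoaction hi (b + c) (p + q) := fun X n => by
  rw [map_add, Subalgebra.coe_add, Polynomial.coeff_add, hp, hq, Polynomial.coeff_add,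
    FiniteDual.add_apply]

theorem IsCoaction.mul {b c : Cusp k} {p q : (D hi)[X]} (hp : IsCoaction hi b p)
    (hq : IsCoaction hi c q) : IsCoaction hi (b * c) (p * q) := fun X n => by
  rw [HSigma.act_mul _ X (ℛ k X), Polynomial.coeff_mul, FiniteDual.sum_apply,
    AddSubmonoidClass.coe_finsetSum, Polynomial.finsetSum_coeff]
  simp only [FiniteDual.mul_apply_repr _ _ (ℛ k X), Subalgebra.coe_mul, Polynomial.coeff_mul,
    hp _ _, hq _ _]
  exact Finset.sum_comm

theorem IsCoaction.algebraMap (r : k) : IsCoaction hi (algebraMap k (Cusp k) r)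
    (Polynomial.C (algebraMap k (D hi) r)) := fun X n => by
  rw [Algebra.algebraMap_eq_smul_one, map_smul, HSigma.act_one, Polynomial.coeff_C,
    Algebra.algebraMap_eq_smul_one]
  split_ifs with h
  · simp [h, FiniteDual.smul_apply, FiniteDual.one_apply]
  · simp [Polynomial.coeff_one, h, FiniteDual.zero_apply]

theorem IsCoaction.e (j : Fin 3) : IsCoaction hi (e k j) (Polynomial.monomial 0 (coef hi 0 j) +
    Polynomial.monomial 2 (coef hi 1 j) + Polynomial.monomial 3 (coef hi 2 j)) := fun X n => by
  rw [act_e]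
  simp only [Fin.sum_univ_three, Polynomial.coeff_add, Polynomial.coeff_monomial,
    FiniteDual.add_apply, apply_ite (fun f : D hi => f X), FiniteDual.zero_apply, coef_apply]
  simp [Cusp.e, x, y, Polynomial.coeff_one, Polynomial.coeff_X_pow, eq_comm]

variable (hi)

/-- Applying the coaction to `t³ * t³ = t² * t² * t²`, with `t² ↦ t² + a₁₂` and
`t³ ↦ t³ ψ + t² φ + γ`, and comparing coefficients. -/
theorem coef_relations :
    coef hi 0 2 * coef hi 0 2 = coef hi 0 1 * coef hi 0 1 * coef hi 0 1 ∧
    coef hi 0 2 * coef hi 1 2 + coef hi 1 2 * coef hi 0 2 = 3 * (coef hi 0 1 * coef hi 0 1) ∧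
    coef hi 0 2 * coef hi 2 2 + coef hi 2 2 * coef hi 0 2 = 0 ∧
    coef hi 1 2 * coef hi 1 2 = 3 * coef hi 0 1 ∧
    coef hi 1 2 * coef hi 2 2 + coef hi 2 2 * coef hi 1 2 = 0 ∧
    coef hi 2 2 * coef hi 2 2 = 1 := by
  have he : e k 2 * e k 2 = e k 1 * e k 1 * e k 1 := by
    apply Subtype.ext
    simp only [e, x, y, Matrix.cons_val, Subalgebra.coe_mul]
    ring
  have h := ((IsCoaction.e (hi := hi) 2).mul (IsCoaction.e 2))
  rw [he] at h
  have h2 := h.unique (((IsCoaction.e (hi := hi) 1).mul (IsCoaction.e 1)).mul (IsCoaction.e 1))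
  rw [coef_one_one, coef_two_one] at h2
  simp only [mul_add, add_mul, Polynomial.monomial_mul_monomial, map_zero, add_zero, mul_one,
    one_mul, zero_add, Nat.reduceAdd] at h2
  have h3 : (3 : D hi) = 1 + 1 + 1 := by norm_num
  refine ⟨?_, ?_, ?_, ?_, ?_, ?_⟩
  · simpa [Polynomial.coeff_monomial] using congrArg (Polynomial.coeff · 0) h2
  · rw [add_comm]
    simpa [Polynomial.coeff_monomial, h3, add_mul, add_assoc] using
      congrArg (Polynomial.coeff · 2) h2
  · rw [add_comm]
    simpa [Polynomial.coeff_monomial] using congrArg (Polynomial.coeff · 3) h2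
  · simpa [Polynomial.coeff_monomial, h3, add_mul, add_assoc] using
      congrArg (Polynomial.coeff · 4) h2
  · rw [add_comm]
    simpa [Polynomial.coeff_monomial] using congrArg (Polynomial.coeff · 5) h2
  · simpa [Polynomial.coeff_monomial] using congrArg (Polynomial.coeff · 6) h2

theorem coef_zero_one : coef hi 0 1 = (1 / 3 : k) • coef hi 1 2 ^ 2 := by
  rw [pow_two, (coef_relations hi).2.2.2.1, ← smul_one_mul (1 / 3 : k)]
  have h3 : (3 : D hi) = (3 : k) • 1 := by
    rw [← Algebra.algebraMap_eq_smul_one, map_ofNat]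
  rw [h3, ← mul_assoc, smul_mul_smul_comm, one_div_mul_cancel (NeZero.ne (3 : k)), one_smul,
    one_mul, one_mul]

/-! ### The antipode on the matrix coefficients -/

theorem sum_antipode_coef_mul (r s : Fin 3) :
    ∑ l, antipode k (coef hi r l) * coef hi l s = if r = s then 1 else 0 := by
  have h := mul_antipode_rTensor_comul_apply (R := k) (coef hi r s)
  rw [comul_coef, counit_coef] at h
  simpa [apply_ite] using h

theorem antipode_coef_two_two : antipode k (coef hi 2 2) = coef hi 2 2 := by
  have h := sum_antipode_coef_mul hi 2 2
  simp only [Fin.sum_univ_three, coef_two_zero, coef_two_one, map_zero, zero_mul, zero_add,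
    if_true] at h
  exact left_inv_eq_right_inv h (coef_relations hi).2.2.2.2.2

theorem antipode_coef_one_two : antipode k (coef hi 1 2) = -(coef hi 1 2 * coef hi 2 2) := by
  have h := sum_antipode_coef_mul hi 1 2
  simp only [Fin.sum_univ_three, coef_one_zero, coef_one_one, map_zero, zero_mul, zero_add,
    antipode_one, one_mul] at h
  have h' := eq_neg_of_add_eq_zero_right (h.trans (if_neg (by decide)))
  rw [← neg_mul, ← h', mul_assoc, (coef_relations hi).2.2.2.2.2, mul_one]

theorem antipode_coef_zero_two : antipode k (coef hi 0 2) =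
    ((1 / 3 : k) • coef hi 1 2 ^ 3 - coef hi 0 2) * coef hi 2 2 := by
  have h1 := sum_antipode_coef_mul hi 0 1
  have h2 := sum_antipode_coef_mul hi 0 2
  simp only [Fin.sum_univ_three, coef_zero_zero, coef_one_one, coef_two_one, mul_zero, add_zero,
    antipode_one, one_mul, mul_one] at h1 h2
  have h1' := eq_neg_of_add_eq_zero_right (h1.trans (if_neg (by decide)))
  have h2' := eq_neg_of_add_eq_zero_right (h2.trans (if_neg (by decide)))
  have h3 : (1 / 3 : k) • coef hi 1 2 ^ 3 - coef hi 0 2 =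
      antipode k (coef hi 0 2) * coef hi 2 2 := by
    rw [h2', h1', coef_zero_one, pow_succ _ 2, neg_mul, smul_mul_assoc]
    noncomm_ring
  rw [h3, mul_assoc, (coef_relations hi).2.2.2.2.2, mul_one]

/-! ### Generators of `A_σ` -/

/-- The morphism `γ, φ, ψ ↦ a₁₃, a₂₃, a₃₃` to the Hopf dual of `H_σ`. -/
noncomputable def freeToDual : Free₃ k →ₐ[k] D hi := FreeAlgebra.lift k fun j => coef hi j 2

theorem freeToDual_ι (j : Fin 3) : freeToDual hi (FreeAlgebra.ι k j) = coef hi j 2 :=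
  FreeAlgebra.lift_ι_apply _ _

theorem coef_mem_range (r s : Fin 3) : coef hi r s ∈ (freeToDual hi).range := by
  have h2 : ∀ j, coef hi j 2 ∈ (freeToDual hi).range := fun j => ⟨_, freeToDual_ι hi j⟩
  fin_cases s
  · fin_cases r
    · exact (coef_zero_zero hi).symm ▸ one_mem _
    · exact (coef_one_zero hi).symm ▸ zero_mem _
    · exact (coef_two_zero hi).symm ▸ zero_mem _
  · fin_cases r
    · exact (coef_zero_one hi).symm ▸ Subalgebra.smul_mem _ (pow_mem (h2 1) 2) _
    · exact (coef_one_one hi).symm ▸ one_mem _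
    · exact (coef_two_one hi).symm ▸ zero_mem _
  · exact h2 r

/-- The subalgebra generated by `γ, φ, ψ` is a Hopf subalgebra. -/
theorem isHopfSubalgebra_range : IsHopfSubalgebra (freeToDual hi).range where
  comul_mem := by
    rintro _ ⟨p, rfl⟩
    change comul (R := k) (freeToDual hi p) ∈ (IsHopfSubalgebra.incl₂ (freeToDual hi).range).range
    induction p using FreeAlgebra.induction with
    | grade0 c =>
      rw [AlgHom.commutes, Bialgebra.comul_algebraMap]
      exact Subalgebra.algebraMap_mem _ c
    | grade1 j =>
      rw [freeToDual_ι, comul_coef]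
      exact sum_mem fun l _ =>
        ⟨⟨_, coef_mem_range hi j l⟩ ⊗ₜ ⟨_, coef_mem_range hi l 2⟩, rfl⟩
    | mul p q hp hq =>
      rw [map_mul, Bialgebra.comul_mul]
      exact mul_mem hp hq
    | add p q hp hq =>
      rw [map_add, map_add]
      exact add_mem hp hq
  antipode_mem := by
    rintro _ ⟨p, rfl⟩
    change antipode k (freeToDual hi p) ∈ (freeToDual hi).range
    have h2 : ∀ j, coef hi j 2 ∈ (freeToDual hi).range := fun j => coef_mem_range hi j 2
    induction p using FreeAlgebra.induction with
    | grade0 c =>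
      rw [AlgHom.commutes, Algebra.algebraMap_eq_smul_one, map_smul, antipode_one]
      exact Subalgebra.smul_mem _ (one_mem _) c
    | grade1 j =>
      rw [freeToDual_ι]
      fin_cases j
      · exact (antipode_coef_zero_two hi).symm ▸ mul_mem
          (sub_mem (Subalgebra.smul_mem _ (pow_mem (h2 1) 3) _) (h2 0)) (h2 2)
      · exact (antipode_coef_one_two hi).symm ▸ neg_mem (mul_mem (h2 1) (h2 2))
      · exact (antipode_coef_two_two hi).symm ▸ h2 2
    | mul p q hp hq =>
      rw [map_mul, antipode_mul_antidistrib]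
      exact mul_mem hq hp
    | add p q hp hq =>
      rw [map_add, map_add]
      exact add_mem hp hq

/-- The coaction takes its values in the subalgebra generated by `γ, φ, ψ`, since this holds for
the algebra generators `t²` and `t³`. -/
theorem exists_isCoaction (b : Cusp k) :
    ∃ p : (D hi)[X], IsCoaction hi b p ∧ ∀ n, p.coeff n ∈ (freeToDual hi).range := by
  obtain ⟨b, hb⟩ := b
  have he : ∀ j : Fin 3, ∃ p : (D hi)[X], IsCoaction hi (e k j) p ∧
      ∀ n, p.coeff n ∈ (freeToDual hi).range := fun j => ⟨_, IsCoaction.e j, fun n => by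
    simp only [Polynomial.coeff_add, Polynomial.coeff_monomial]
    refine add_mem (add_mem ?_ ?_) ?_
    all_goals
      split_ifs
      · exact coef_mem_range hi _ _
      · exact zero_mem _⟩
  induction hb using Algebra.adjoin_induction with
  | mem b hb =>
    have hb' := Algebra.subset_adjoin (R := k) hb
    rcases hb with rfl | rfl
    · have h : (⟨_, hb'⟩ : Cusp k) = e k 1 := rfl
      rw [h]
      exact he 1
    · have h : (⟨_, hb'⟩ : Cusp k) = e k 2 := rfl
      rw [h]
      exact he 2
  | algebraMap c =>
    refine ⟨_, IsCoaction.algebraMap c, fun n => ?_⟩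
    rw [Polynomial.coeff_C]
    split_ifs
    · exact Subalgebra.algebraMap_mem _ c
    · exact zero_mem _
  | add b c hb hc ihb ihc =>
    obtain ⟨p, hp, hp'⟩ := ihb
    obtain ⟨q, hq, hq'⟩ := ihc
    exact ⟨p + q, hp.add hq, fun n => by
      rw [Polynomial.coeff_add]
      exact add_mem (hp' n) (hq' n)⟩
  | mul b c hb hc ihb ihc =>
    obtain ⟨p, hp, hp'⟩ := ihb
    obtain ⟨q, hq, hq'⟩ := ihc
    have h : (⟨b * c, mul_mem hb hc⟩ : Cusp k) = ⟨b, hb⟩ * ⟨c, hc⟩ := rfl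
    rw [h]
    exact ⟨p * q, hp.mul hq, fun n => by
      rw [Polynomial.coeff_mul]
      exact sum_mem fun j _ => mul_mem (hp' _) (hq' _)⟩

/-- All matrix coefficients of `k[t², t³]` are polynomials in `γ, φ, ψ`. -/
theorem matrixCoeffs_subset_range :
    matrixCoeffs (isQuantumAut_sigma hi) ⊆ (freeToDual hi).range := by
  rintro a ⟨b, f, hf⟩
  obtain ⟨p, hp, hp'⟩ := exists_isCoaction hi b
  -- the powers of `t` do not all lie in `k[t², t³]`, so `f` is extended to `k[t]`
  obtain ⟨F, hF⟩ := LinearMap.exists_extend (p := Subalgebra.toSubmodule (Cusp k)) f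
  have ha : a = ∑ n ∈ p.support, F (Polynomial.X ^ n) • p.coeff n := by
    apply FiniteDual.ext
    intro X
    have h1 : f (HSigma.act (isQuantumAut_sigma hi) X b) =
        F (HSigma.act (isQuantumAut_sigma hi) X b : k[X]) := (LinearMap.congr_fun hF _).symm
    have h2 : (HSigma.act (isQuantumAut_sigma hi) X b : k[X]) =
        ∑ n ∈ p.support, p.coeff n X • Polynomial.X ^ n := by
      ext n
      simp only [hp X n, Polynomial.finsetSum_coeff, Polynomial.coeff_smul,
        Polynomial.coeff_X_pow, smul_eq_mul, mul_ite, mul_one, mul_zero, Finset.sum_ite_eq]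
      split_ifs with hn
      · rfl
      · rw [Polynomial.notMem_support_iff.1 hn, FiniteDual.zero_apply]
    rw [hf, h1, h2, map_sum, FiniteDual.sum_apply]
    exact Finset.sum_congr rfl fun n _ => by
      rw [map_smul, FiniteDual.smul_apply, smul_eq_mul, mul_comm]
  rw [ha]
  exact sum_mem fun n _ => Subalgebra.smul_mem _ (hp' n) _

theorem coef_mem_matrixCoeffs (r s : Fin 3) :
    coef hi r s ∈ matrixCoeffs (isQuantumAut_sigma hi) := by
  refine ⟨e k s, Polynomial.lcoeff k (![0, 2, 3] r) ∘ₗ (Cusp k).val.toLinearMap, fun X => ?_⟩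
  rw [act_e, coef_apply]
  fin_cases r <;> simp [Fin.sum_univ_three, e, x, y, Polynomial.coeff_one, Polynomial.coeff_X_pow]

/-! ### Right translation by the entries of `s 0` -/

/-- The matrix `(M r s • f)` over an algebra. -/
def scalarMul {k R : Type*} [Field k] [Ring R] [Algebra k R] (M : Matrix (Fin 3) (Fin 3) k)
    (f : R) : Matrix (Fin 3) (Fin 3) R := M.map (· • f)

theorem scalarMul_mul_scalarMul {k R : Type*} [Field k] [Ring R] [Algebra k R]
    (M N : Matrix (Fin 3) (Fin 3) k) (f g : R) :
    scalarMul M f * scalarMul N g = scalarMul (M * N) (f * g) := by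
  ext r s
  simp [scalarMul, Matrix.mul_apply, Finset.sum_smul, smul_smul, mul_comm]

theorem scalarMul_one_one {k R : Type*} [Field k] [Ring R] [Algebra k R] :
    scalarMul (1 : Matrix (Fin 3) (Fin 3) k) (1 : R) = 1 := by
  ext r s
  simp [scalarMul, Matrix.one_apply]

/-- The values `ψ (s 0 r s)`. -/
def psiMat (k : Type*) [Field k] : Matrix (Fin 3) (Fin 3) k := !![1, 1, -(1 / 2); 0, -1, 1; 0, 0, 1]

/-- The values `φ (s 0 r s)`. -/
def phiMat (i : k) : Matrix (Fin 3) (Fin 3) k := !![0, -i, 0; 0, 0, i; 0, 0, 0]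

theorem coef_mul_s_zero (j r s : Fin 3) (Y : H hi) :
    coef hi j 2 (Y * HSigma.s (isQuantumAut_sigma hi) 0 r s) =
      phiMat i r s * coef hi j 1 Y + psiMat k r s * coef hi j 2 Y := by
  rw [coef_apply, map_mul, Matrix.mul_apply, rep_s_zero, Fin.sum_univ_three]
  fin_cases r <;> fin_cases s <;>
    simp [sigmaFlag, upperTri, flagK, flagU, phiMat, psiMat, coef_apply, mul_comm]

/-- The matrix of right translations by the elements `s 0 r s`. -/
noncomputable def translate : Free₃ k →ₐ[k] Matrix (Fin 3) (Fin 3) (D hi) :=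
  FreeAlgebra.lift k fun j =>
    scalarMul (phiMat i) (coef hi j 1) + scalarMul (psiMat k) (coef hi j 2)

/-- Since the matrix `s 0` is comultiplicative, right translation of functionals by its entries is
an algebra morphism to matrices, and so it can be computed on generators. -/
theorem translate_apply (p : Free₃ k) (r s : Fin 3) (Y : H hi) : translate hi p r s Y =
    freeToDual hi p (Y * HSigma.s (isQuantumAut_sigma hi) 0 r s) := by
  induction p using FreeAlgebra.induction generalizing r s Y with
  | grade0 c =>
    rw [AlgHom.commutes, AlgHom.commutes, Matrix.algebraMap_matrix_apply,
      Algebra.algebraMap_eq_smul_one, FiniteDual.smul_apply, FiniteDual.one_apply,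
      Bialgebra.counit_mul, HSigma.counit_s]
    split_ifs
    · rw [FiniteDual.smul_apply, FiniteDual.one_apply, mul_one]
    · simp [FiniteDual.zero_apply]
  | grade1 j =>
    rw [freeToDual_ι, coef_mul_s_zero, translate, FreeAlgebra.lift_ι_apply]
    rfl
  | add p q hp hq =>
    rw [map_add, map_add, Matrix.add_apply, FiniteDual.add_apply, FiniteDual.add_apply, hp, hq]
  | mul p q hp hq =>
    rw [map_mul, map_mul, Matrix.mul_apply, FiniteDual.sum_apply, FiniteDual.mul_apply,
      Bialgebra.comul_mul, HSigma.comul_s, ← (ℛ k Y).eq]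
    simp only [Finset.sum_mul_sum, Algebra.TensorProduct.tmul_mul_tmul, map_sum,
      FiniteDual.pair₂_tmul, FiniteDual.mul_apply_repr _ _ (ℛ k Y), hp, hq]
    exact Finset.sum_comm

/-- A basis of eigenvectors of `psiMat`, with eigenvalues `1, -1, 1`, in which `phiMat` takes
its Jordan form. -/
def eigen (i : k) : Matrix (Fin 3) (Fin 3) k := !![1, -(i / 2), 0; 0, i, 1 / 2; 0, 0, 1]

/-- The inverse of `eigen`. -/
def eigenInv (i : k) : Matrix (Fin 3) (Fin 3) k := !![1, 1 / 2, -(1 / 4); 0, -i, i / 2; 0, 0, 1]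

/-- The diagonal form of `psiMat`. -/
def psiDiag (k : Type*) [Field k] : Matrix (Fin 3) (Fin 3) k := !![1, 0, 0; 0, -1, 0; 0, 0, 1]

/-- The Jordan form of `phiMat`. -/
def phiJordan (k : Type*) [Field k] : Matrix (Fin 3) (Fin 3) k := !![0, 1, 0; 0, 0, 1; 0, 0, 0]

theorem eigenInv_mul_eigen {k : Type*} [Field k] [NeZero (2 : k)] {i : k} (hi : i ^ 2 = -1) :
    eigenInv i * eigen i = 1 := by
  have h2 := NeZero.ne (2 : k)
  have h4 : (4 : k) = 2 * 2 := by norm_num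
  ext r s
  fin_cases r <;> fin_cases s <;>
    simp [eigen, eigenInv, Matrix.mul_apply, Fin.sum_univ_three, h4]
  all_goals grind

theorem eigen_mul_psiDiag {k : Type*} [Field k] [NeZero (2 : k)] (i : k) :
    eigen i * psiDiag k = psiMat k * eigen i := by
  have h2 := NeZero.ne (2 : k)
  ext r s
  fin_cases r <;> fin_cases s <;>
    simp [eigen, psiDiag, psiMat, Matrix.mul_apply, Fin.sum_univ_three]
  all_goals grind

theorem eigen_mul_phiJordan {k : Type*} [Field k] [NeZero (2 : k)] {i : k} (hi : i ^ 2 = -1) :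
    eigen i * phiJordan k = phiMat i * eigen i := by
  have h2 := NeZero.ne (2 : k)
  ext r s
  fin_cases r <;> fin_cases s <;>
    simp [eigen, phiJordan, phiMat, Matrix.mul_apply, Fin.sum_univ_three]
  all_goals grind

/-- The translations `translate`, after a change of basis. -/
noncomputable def translateDiag : Free₃ k →ₐ[k] Matrix (Fin 3) (Fin 3) (D hi) :=
  FreeAlgebra.lift k fun j =>
    scalarMul (phiJordan k) (coef hi j 1) + scalarMul (psiDiag k) (coef hi j 2)

theorem eigen_mul_translateDiag (p : Free₃ k) :
    scalarMul (eigen i) 1 * translateDiag hi p = translate hi p * scalarMul (eigen i) 1 := by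
  induction p using FreeAlgebra.induction with
  | grade0 c => rw [AlgHom.commutes, AlgHom.commutes, Algebra.commutes]
  | grade1 j =>
    rw [translateDiag, translate, FreeAlgebra.lift_ι_apply, FreeAlgebra.lift_ι_apply]
    simp only [mul_add, add_mul, scalarMul_mul_scalarMul, eigen_mul_psiDiag,
      eigen_mul_phiJordan hi, one_mul, mul_one]
  | add p q hp hq => rw [map_add, map_add, mul_add, add_mul, hp, hq]
  | mul p q hp hq => rw [map_mul, map_mul, ← mul_assoc, hp, mul_assoc, hq, mul_assoc]

theorem translateDiag_eq_zero {p : Free₃ k} (hp : freeToDual hi p = 0) :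
    translateDiag hi p = 0 := by
  have h : translate hi p = 0 := by
    ext r s : 2
    apply FiniteDual.ext
    intro Y
    rw [translate_apply, hp]
    rfl
  have h' := congrArg (scalarMul (eigenInv i) 1 * ·) (eigen_mul_translateDiag hi p)
  simpa only [h, zero_mul, mul_zero, ← mul_assoc, scalarMul_mul_scalarMul, eigenInv_mul_eigen hi,
    one_mul, scalarMul_one_one] using h'

end Cusp

/-! ### Normal forms -/

section NormalForm

variable {k R : Type*} [Field k] [Ring R] [Algebra k R]

/-- The element `u₁(c) + u₂(c) s`. -/
noncomputable def linComb (c s : R) (u : k[X] × k[X]) : R :=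
  Polynomial.aeval c u.1 + Polynomial.aeval c u.2 * s

/-- The element `h₀ + f h₁ + g h₂ + f g h₃`, where each `hⱼ` is a combination of `1` and `s` with
polynomials in `f²` as coefficients. -/
noncomputable def normalForm (g f s : R) (u : Fin 4 → k[X] × k[X]) : R :=
  linComb (f ^ 2) s (u 0) + f * linComb (f ^ 2) s (u 1) + g * linComb (f ^ 2) s (u 2) +
    f * g * linComb (f ^ 2) s (u 3)

theorem linComb_add (c s : R) (u v : k[X] × k[X]) :
    linComb c s (u + v) = linComb c s u + linComb c s v := by
  simp only [linComb, Prod.fst_add, Prod.snd_add, map_add, add_mul]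
  abel

theorem linComb_zero (c s : R) : linComb c s (0 : k[X] × k[X]) = 0 := by
  simp [linComb]

theorem linComb_neg (c s : R) (u : k[X] × k[X]) : linComb c s (-u) = -linComb c s u := by
  simp only [linComb, Prod.fst_neg, Prod.snd_neg, map_neg, neg_mul]
  abel

theorem normalForm_add (g f s : R) (u v : Fin 4 → k[X] × k[X]) :
    normalForm g f s (u + v) = normalForm g f s u + normalForm g f s v := by
  simp only [normalForm, Pi.add_apply, linComb_add, mul_add]
  abel

theorem normalForm_smul (g f s : R) (r : k) (u : Fin 4 → k[X] × k[X]) :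
    normalForm g f s (r • u) = r • normalForm g f s u := by
  simp only [normalForm, linComb, Pi.smul_apply, Prod.smul_fst, Prod.smul_snd, map_smul,
    smul_mul_assoc, ← smul_add, mul_smul_comm]

theorem map_normalForm {R' : Type*} [Ring R'] [Algebra k R'] (F : R →ₐ[k] R') (g f s : R)
    (u : Fin 4 → k[X] × k[X]) : F (normalForm g f s u) = normalForm (F g) (F f) (F s) u := by
  simp [normalForm, linComb, ← Polynomial.aeval_algHom_apply]

/-- In an algebra where the relations hold and `3` is invertible, every polynomial in the
generators has a normal form. -/
theorem exists_normalForm [NeZero (3 : k)] {g f s : R} (hs : s ^ 2 = 1) (hgs : g * s + s * g = 0)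
    (hfs : f * s + s * f = 0) (hg : 27 * g ^ 2 = f ^ 6) (hgf : 3 * (g * f + f * g) = f ^ 4)
    (p : Free₃ k) :
    ∃ u : Fin 4 → k[X] × k[X], FreeAlgebra.lift k ![g, f, s] p = normalForm g f s u := by
  have h3 : (3 : k) ≠ 0 := NeZero.ne _
  -- the relations as rewriting rules
  have rs : s * s = 1 := by rw [← pow_two, hs]
  have rsg : s * g = -(g * s) := eq_neg_of_add_eq_zero_right hgs
  have rsf : s * f = -(f * s) := eq_neg_of_add_eq_zero_right hfs
  have rgf : g * f = (1 / 3 : k) • (f ^ 2 * f ^ 2) - f * g := by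
    rw [eq_sub_iff_add_eq, ← pow_add, ← hgf, ← smul_one_mul]
    have : (3 : R) = (3 : k) • 1 := by rw [← Algebra.algebraMap_eq_smul_one, map_ofNat]
    rw [this, ← mul_assoc, smul_mul_smul_comm, one_div_mul_cancel h3, one_smul, one_mul, one_mul]
  have rgg : g * g = (1 / 27 : k) • (f ^ 2 * f ^ 2 * f ^ 2) := by
    rw [← pow_add, ← pow_add, ← hg, ← smul_one_mul]
    have h27 : (27 : k) ≠ 0 := by
      have : (27 : k) = 3 ^ 3 := by norm_num
      rw [this]
      exact pow_ne_zero _ h3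
    have : (27 : R) = (27 : k) • 1 := by rw [← Algebra.algebraMap_eq_smul_one, map_ofNat]
    rw [this, ← mul_assoc, smul_mul_smul_comm, one_div_mul_cancel h27, one_smul, one_mul, one_mul,
      pow_two]
  -- `f ^ 2` is central
  have cs : s * f ^ 2 = f ^ 2 * s := by
    rw [pow_two, ← mul_assoc, rsf, neg_mul, mul_assoc, rsf]; noncomm_ring
  have cg : g * f ^ 2 = f ^ 2 * g := by
    have : g * f ^ 2 = g * f * f := by rw [pow_two, mul_assoc]
    rw [this, rgf, sub_mul, mul_assoc f g f, rgf, mul_sub, mul_smul_comm, smul_mul_assoc]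
    have : f ^ 2 * f ^ 2 * f = f * (f ^ 2 * f ^ 2) := by noncomm_ring
    rw [this]
    noncomm_ring
  generalize hc : f ^ 2 = c at *
  have cf : f * c = c * f := by rw [← hc]; noncomm_ring
  have comm : ∀ {x : R}, x * c = c * x → ∀ q : k[X],
      x * Polynomial.aeval c q = Polynomial.aeval c q * x := fun {x} hx q => by
    induction q using Polynomial.induction_on with
    | C a => simp [Algebra.commutes]
    | add p q hp hq => rw [map_add, mul_add, add_mul, hp, hq]
    | monomial n a ih =>
      rw [pow_succ, ← mul_assoc, map_mul, ← mul_assoc, ih, mul_assoc, Polynomial.aeval_X, hx,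
        mul_assoc]
  have hlc : ∀ (q : k[X]) (u : k[X] × k[X]),
      linComb c s (q * u.1, q * u.2) = Polynomial.aeval c q * linComb c s u := by
    intro q u
    simp only [linComb, map_mul, mul_add, mul_assoc]
  have hls : ∀ u : k[X] × k[X], s * linComb c s u = linComb c s (u.2, u.1) := by
    intro u
    simp only [linComb, mul_add, ← mul_assoc, comm cs]
    rw [mul_assoc _ s s, rs, mul_one, add_comm]
  -- the polynomials with `g f + f g = q₂(f²)` and `g² = q₃(f²)`
  let q₂ : k[X] := Polynomial.C (1 / 3) * Polynomial.X ^ 2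
  let q₃ : k[X] := Polynomial.C (1 / 27) * Polynomial.X ^ 3
  have hq₂ : Polynomial.aeval c q₂ = (1 / 3 : k) • (c * c) := by
    simp [q₂, Algebra.smul_def, pow_two]
  have hq₃ : Polynomial.aeval c q₃ = (1 / 27 : k) • (c * c * c) := by
    simp [q₃, Algebra.smul_def, pow_succ]
  rw [← hq₂] at rgf
  rw [← hq₃] at rgg
  -- left multiplication by the generators preserves normal forms
  have key : ∀ u : Fin 4 → k[X] × k[X], ∃ v : Fin 4 → k[X] × k[X],
      FreeAlgebra.lift k ![g, f, s] p * normalForm g f s u =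
      normalForm g f s v := by
    induction p using FreeAlgebra.induction with
    | grade0 r => exact fun u => ⟨r • u, by rw [normalForm_smul]; simp [Algebra.smul_def]⟩
    | add p q hp hq =>
      intro u
      obtain ⟨v, hv⟩ := hp u
      obtain ⟨w, hw⟩ := hq u
      exact ⟨v + w, by rw [normalForm_add, map_add, add_mul, hv, hw]⟩
    | mul p q hp hq =>
      intro u
      obtain ⟨v, hv⟩ := hq u
      obtain ⟨w, hw⟩ := hp v
      exact ⟨w, by rw [map_mul, mul_assoc, hv, hw]⟩
    | grade1 j =>
      intro u
      rw [FreeAlgebra.lift_ι_apply]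
      fin_cases j
      · refine ⟨![(q₂ * (u 1).1, q₂ * (u 1).2) + (q₃ * (u 2).1, q₃ * (u 2).2),
          -(q₃ * (u 3).1, q₃ * (u 3).2), u 0 + (q₂ * (u 3).1, q₂ * (u 3).2), -u 1], ?_⟩
        simp only [normalForm, hc, Matrix.cons_val, linComb_add, linComb_neg, hlc, Fin.zero_eta]
        generalize linComb c s (u 0) = h₀
        generalize linComb c s (u 1) = h₁
        generalize linComb c s (u 2) = h₂
        generalize linComb c s (u 3) = h₃
        have e₁ : g * (f * h₁) = Polynomial.aeval c q₂ * h₁ - f * g * h₁ := by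
          rw [← mul_assoc, rgf, sub_mul]
        have e₂ : g * (g * h₂) = Polynomial.aeval c q₃ * h₂ := by rw [← mul_assoc, rgg]
        have e₃ : g * (f * g * h₃) =
            g * (Polynomial.aeval c q₂ * h₃) - f * (Polynomial.aeval c q₃ * h₃) := by
          rw [← mul_assoc, ← mul_assoc, rgf, ← mul_assoc, comm cg, sub_mul, sub_mul, ← rgg]
          noncomm_ring
        rw [mul_add, mul_add, mul_add, e₁, e₂, e₃]
        noncomm_ring
      · refine ⟨![(Polynomial.X * (u 1).1, Polynomial.X * (u 1).2), u 0,
          (Polynomial.X * (u 3).1, Polynomial.X * (u 3).2), u 2], ?_⟩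
        simp only [normalForm, hc, Matrix.cons_val, hlc, Polynomial.aeval_X, ← mul_assoc, cg,
          Fin.mk_one]
        rw [← hc]
        noncomm_ring
      · refine ⟨![(u 0).swap, -(u 1).swap, -(u 2).swap, (u 3).swap], ?_⟩
        simp only [normalForm, hc, Matrix.cons_val, linComb_neg, Prod.swap, ← hls,
          Fin.reduceFinMk]
        generalize linComb c s (u 0) = h₀
        generalize linComb c s (u 1) = h₁
        generalize linComb c s (u 2) = h₂
        generalize linComb c s (u 3) = h₃
        have e₃ : s * (f * g * h₃) = f * g * (s * h₃) := by
          rw [← mul_assoc, ← mul_assoc, rsf, neg_mul, mul_assoc f s g, rsg]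
          noncomm_ring
        rw [mul_add, mul_add, mul_add, e₃, ← mul_assoc s f, ← mul_assoc s g, rsf, rsg]
        noncomm_ring
  obtain ⟨v, hv⟩ := key ![(1, 0), 0, 0, 0]
  refine ⟨v, by rw [← hv]; simp [normalForm, linComb]⟩

end NormalForm

/-! ### Linear independence of the normal forms -/

/-- The matrix is `c + ε`, where `ε` commutes with `c` and `ε² = 0`. -/
theorem aeval_eq_derivative {k R : Type*} [Field k] [Ring R] [Algebra k R] (c : R) (q : k[X]) :
    Polynomial.aeval (!![c, 0, 1; 0, c, 0; 0, 0, c] : Matrix (Fin 3) (Fin 3) R) q =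
      !![Polynomial.aeval c q, 0, Polynomial.aeval c (Polynomial.derivative q);
        0, Polynomial.aeval c q, 0; 0, 0, Polynomial.aeval c q] := by
  induction q using Polynomial.induction_on' with
  | add p q hp hq =>
    rw [map_add, hp, hq]
    ext r s
    fin_cases r <;> fin_cases s <;> simp
  | monomial n a =>
    induction n with
    | zero =>
      ext r s
      fin_cases r <;> fin_cases s <;> simp [Matrix.algebraMap_matrix_apply]
    | succ n ih =>
      rw [← Polynomial.monomial_mul_X, map_mul, ih, Polynomial.aeval_X, Polynomial.derivative_mul,
        Polynomial.derivative_X, mul_one]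
      generalize Polynomial.monomial n a = q
      ext r s
      fin_cases r <;> fin_cases s <;> simp [Matrix.mul_apply, Fin.sum_univ_three, add_comm]

theorem linComb_C_mul_X_mul {k R : Type*} [Field k] [Ring R] [Algebra k R] (c s : R) (r : k)
    (p q : k[X]) :
    linComb c s (Polynomial.C r * Polynomial.X * p, Polynomial.C r * Polynomial.X * q) =
      r • c * linComb c s (p, q) := by
  simp [linComb, mul_add, mul_assoc, Algebra.smul_def]

theorem linComb_matrix {k R : Type*} [Field k] [Ring R] [Algebra k R] (c s : R)
    (u : k[X] × k[X]) :
    linComb (!![c, 0, 1; 0, c, 0; 0, 0, c] : Matrix (Fin 3) (Fin 3) R)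
      !![s, 0, 0; 0, -s, 0; 0, 0, s] u =
    !![linComb c s u, 0, linComb c s (u.map Polynomial.derivative Polynomial.derivative);
      0, linComb c s (u.1, -u.2), 0; 0, 0, linComb c s u] := by
  rw [linComb, aeval_eq_derivative, aeval_eq_derivative]
  ext r t
  fin_cases r <;> fin_cases t <;> simp [linComb]

namespace Cusp

variable {k : Type*} [Field k] [NeZero (2 : k)] [NeZero (3 : k)] {i : k} (hi : i ^ 2 = -1)

/-- The two entries of `translateDiag` above the diagonal of its first row, on a normal form
that vanishes as a functional. -/
theorem translateDiag_normalForm (u : Fin 4 → k[X] × k[X])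
    (h : normalForm (coef hi 0 2) (coef hi 1 2) (coef hi 2 2) u = 0) :
    linComb (coef hi 1 2 ^ 2) (coef hi 2 2) ((u 1).1, -(u 1).2) +
      coef hi 0 1 * linComb (coef hi 1 2 ^ 2) (coef hi 2 2) ((u 2).1, -(u 2).2) +
      (coef hi 1 2 * coef hi 0 1 - coef hi 0 2) *
        linComb (coef hi 1 2 ^ 2) (coef hi 2 2) ((u 3).1, -(u 3).2) = 0 ∧
    normalForm (coef hi 0 2) (coef hi 1 2) (coef hi 2 2)
      (fun j => (u j).map Polynomial.derivative Polynomial.derivative) +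
      coef hi 0 1 * linComb (coef hi 1 2 ^ 2) (coef hi 2 2) (u 3) = 0 := by
  have h0 : freeToDual hi (normalForm (Free₃.γ k) (Free₃.φ k) (Free₃.ψ k) u) = 0 := by
    rw [map_normalForm, Free₃.γ, Free₃.φ, Free₃.ψ, freeToDual_ι, freeToDual_ι, freeToDual_ι, h]
  have h1 := translateDiag_eq_zero hi h0
  have hγ : translateDiag hi (Free₃.γ k) = !![coef hi 0 2, coef hi 0 1, 0;
      0, -coef hi 0 2, coef hi 0 1; 0, 0, coef hi 0 2] := by
    rw [translateDiag, Free₃.γ, FreeAlgebra.lift_ι_apply]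
    ext r s : 2
    fin_cases r <;> fin_cases s <;> simp [scalarMul, phiJordan, psiDiag]
  have hφ : translateDiag hi (Free₃.φ k) = !![coef hi 1 2, 1, 0;
      0, -coef hi 1 2, 1; 0, 0, coef hi 1 2] := by
    rw [translateDiag, Free₃.φ, FreeAlgebra.lift_ι_apply, coef_one_one]
    ext r s : 2
    fin_cases r <;> fin_cases s <;> simp [scalarMul, phiJordan, psiDiag]
  have hψ : translateDiag hi (Free₃.ψ k) = !![coef hi 2 2, 0, 0;
      0, -coef hi 2 2, 0; 0, 0, coef hi 2 2] := by
    rw [translateDiag, Free₃.ψ, FreeAlgebra.lift_ι_apply, coef_two_one]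
    ext r s : 2
    fin_cases r <;> fin_cases s <;> simp [scalarMul, phiJordan, psiDiag]
  have hφ2 : translateDiag hi (Free₃.φ k) ^ 2 = !![coef hi 1 2 ^ 2, 0, 1;
      0, coef hi 1 2 ^ 2, 0; 0, 0, coef hi 1 2 ^ 2] := by
    rw [hφ, pow_two, pow_two]
    ext r s : 2
    fin_cases r <;> fin_cases s <;> simp [Matrix.mul_apply, Fin.sum_univ_three]
  rw [map_normalForm, normalForm, hφ2, hψ, hφ, hγ] at h1
  simp only [linComb_matrix] at h1
  constructor
  · have := congrFun (congrFun h1 0) 1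
    simpa [Matrix.mul_apply, Fin.sum_univ_three, sub_eq_add_neg] using this
  · have := congrFun (congrFun h1 0) 2
    simpa [Matrix.mul_apply, Fin.sum_univ_three, normalForm, add_assoc] using this

/-- `1` and `ψ` are linearly independent: evaluate at `1` and at the grouplike `s 0 1 1`. -/
theorem smul_one_add_smul_psi_eq_zero {x y : k} (h : x • 1 + y • coef hi 2 2 = 0) :
    x = 0 ∧ y = 0 := by
  have h2 := NeZero.ne (2 : k)
  have e1 : x + y = 0 := by
    have := congrArg (fun f : D hi => f 1) h
    simpa [FiniteDual.add_apply, FiniteDual.smul_apply, FiniteDual.one_apply, coef_apply,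
      FiniteDual.zero_apply] using this
  have e2 : x - y = 0 := by
    have := congrArg (fun f : D hi => f (HSigma.s (isQuantumAut_sigma hi) 0 1 1)) h
    simpa [FiniteDual.add_apply, FiniteDual.smul_apply, FiniteDual.one_apply, coef_apply,
      FiniteDual.zero_apply, rep_s_zero, HSigma.counit_s, sigmaFlag, upperTri, flagK,
      sub_eq_add_neg] using this
  constructor <;> grind

theorem linComb_C (x y : k) (c : D hi) :
    linComb c (coef hi 2 2) (Polynomial.C x, Polynomial.C y) = x • 1 + y • coef hi 2 2 := by
  simp [linComb, Algebra.algebraMap_eq_smul_one]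

/-- Normal forms without a term in `φ γ` are unique, by induction on the degree of the coefficients:
the corner entry of `translateDiag` differentiates the coefficients. So in characteristic `0`
one may assume them to be constants, and then the entry next to the diagonal is a relation of
lower degree in which the coefficient of `γ` appears with a factor `φ²`. -/
theorem eq_zero_of_normalForm_eq_zero [CharZero k] (n : ℕ) (u : Fin 4 → k[X] × k[X])
    (h3 : u 3 = 0) (hn : ∀ j, Polynomial.derivative^[n] (u j).1 = 0 ∧
      Polynomial.derivative^[n] (u j).2 = 0)
    (h : normalForm (coef hi 0 2) (coef hi 1 2) (coef hi 2 2) u = 0) : u = 0 := by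
  induction n generalizing u with
  | zero => exact funext fun j => Prod.ext (hn j).1 (hn j).2
  | succ n ih =>
    obtain ⟨h1, h2⟩ := translateDiag_normalForm hi u h
    rw [h3, linComb_zero, mul_zero, add_zero] at h2
    have hd := ih (fun j => (u j).map Polynomial.derivative Polynomial.derivative)
      (by simp [h3, Prod.ext_iff]) (fun j => hn j) h2
    have hC : ∀ j, ∃ x y : k, u j = (Polynomial.C x, Polynomial.C y) := fun j => by
      have hj := congrFun hd j
      have e1 := Polynomial.derivative_eq_zero.1 (congrArg Prod.fst hj)
      have e2 := Polynomial.derivative_eq_zero.1 (congrArg Prod.snd hj)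
      exact ⟨_, _, Prod.ext (Polynomial.eq_C_of_natDegree_eq_zero e1)
        (Polynomial.eq_C_of_natDegree_eq_zero e2)⟩
    obtain ⟨x₀, y₀, h₀⟩ := hC 0
    obtain ⟨x₁, y₁, h₁⟩ := hC 1
    obtain ⟨x₂, y₂, h₂⟩ := hC 2
    rw [h₁, h₂, h3, Prod.fst_zero, Prod.snd_zero, neg_zero, Prod.mk_zero_zero, linComb_zero,
      mul_zero, add_zero, coef_zero_one] at h1
    -- the relation between `1`, `ψ`, `φ²` and `φ² ψ`, as a normal form
    have hv := (translateDiag_normalForm hi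
      ![(Polynomial.C x₁, -Polynomial.C y₁) +
        (Polynomial.C (1 / 3) * Polynomial.X * Polynomial.C x₂,
          Polynomial.C (1 / 3) * Polynomial.X * -Polynomial.C y₂), 0, 0, 0] (by
        rw [← h1]
        simp only [normalForm, Matrix.cons_val, linComb_add, linComb_zero, linComb_C_mul_X_mul,
          mul_zero, add_zero])).2
    have hv' : linComb (coef hi 1 2 ^ 2) (coef hi 2 2)
        (Polynomial.C (1 / 3 * x₂), Polynomial.C (-(1 / 3 * y₂))) = 0 := by
      rw [← hv]
      simp [normalForm, linComb]
    rw [linComb_C] at hv'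
    obtain ⟨hx₂, hy₂⟩ := smul_one_add_smul_psi_eq_zero hi hv'
    have hx₂' : x₂ = 0 := by simpa using hx₂
    have hy₂' : y₂ = 0 := by simpa using hy₂
    subst hx₂' hy₂'
    rw [map_zero, neg_zero, Prod.mk_zero_zero, linComb_zero, mul_zero, add_zero, ← map_neg,
      linComb_C] at h1
    obtain ⟨hx₁, hy₁⟩ := smul_one_add_smul_psi_eq_zero hi h1
    rw [neg_eq_zero] at hy₁
    subst hx₁ hy₁
    rw [normalForm, h₀, h₁, h₂, h3, map_zero, Prod.mk_zero_zero, linComb_zero, mul_zero, mul_zero,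
      mul_zero, add_zero, add_zero, add_zero, linComb_C] at h
    obtain ⟨hx₀, hy₀⟩ := smul_one_add_smul_psi_eq_zero hi h
    subst hx₀ hy₀
    funext j
    fin_cases j
    · simpa [Prod.ext_iff] using h₀
    · simpa [Prod.ext_iff] using h₁
    · simpa [Prod.ext_iff] using h₂
    · exact h3

/-- Normal forms are unique in characteristic `0`. Applied to a vanishing normal form, the skew
derivation next to the diagonal of `translateDiag` gives a vanishing normal form without a term in
`φ γ`, in which `γ` has the old coefficient of `φ γ` up to signs. -/
theorem normalForm_injective [CharZero k] {u : Fin 4 → k[X] × k[X]}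
    (h : normalForm (coef hi 0 2) (coef hi 1 2) (coef hi 2 2) u = 0) : u = 0 := by
  have key : ∀ v : Fin 4 → k[X] × k[X], v 3 = 0 →
      normalForm (coef hi 0 2) (coef hi 1 2) (coef hi 2 2) v = 0 → v = 0 := fun v h3 hv => by
    refine eq_zero_of_normalForm_eq_zero hi
      (∑ j, ((v j).1.natDegree + (v j).2.natDegree) + 1) v h3 (fun j => ?_) hv
    have := Finset.single_le_sum (f := fun j => (v j).1.natDegree + (v j).2.natDegree)
      (fun _ _ => Nat.zero_le _) (Finset.mem_univ j)
    constructor <;> apply Polynomial.iterate_derivative_eq_zero <;> lia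
  have h1 := (translateDiag_normalForm hi u h).1
  have h2 := key ![((u 1).1, -(u 1).2) + (Polynomial.C (1 / 3) * Polynomial.X * (u 2).1,
      Polynomial.C (1 / 3) * Polynomial.X * -(u 2).2),
    (Polynomial.C (1 / 3) * Polynomial.X * (u 3).1,
      Polynomial.C (1 / 3) * Polynomial.X * -(u 3).2), -((u 3).1, -(u 3).2), 0] rfl (by
    rw [← h1, coef_zero_one]
    simp only [normalForm, Matrix.cons_val, linComb_add, linComb_zero, linComb_neg,
      linComb_C_mul_X_mul, mul_zero, add_zero]
    noncomm_ring)
  refine key u ?_ h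
  have := congrFun h2 2
  simpa [Prod.ext_iff] using this

/-! ### The presentation -/

theorem freeToDual_relators {p : Free₃ k} (hp : p ∈ Free₃.relators k) :
    freeToDual hi p = 0 := by
  obtain ⟨h1, h2, h3, h4, h5, h6⟩ := coef_relations hi
  have hc : coef hi 0 1 * coef hi 1 2 ^ 2 = coef hi 1 2 ^ 2 * coef hi 0 1 := by
    rw [coef_zero_one, smul_mul_assoc, mul_smul_comm]
  rw [← pow_two] at h4
  rcases hp with rfl | rfl | rfl | rfl | rfl
  · simp [Free₃.ψ, freeToDual_ι, pow_two, h6]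
  · simp [Free₃.γ, Free₃.ψ, freeToDual_ι, h3]
  · simp [Free₃.φ, Free₃.ψ, freeToDual_ι, h5]
  · have : coef hi 1 2 ^ 6 = coef hi 1 2 ^ 2 * coef hi 1 2 ^ 2 * coef hi 1 2 ^ 2 := by
      rw [← pow_add, ← pow_add]
    simp only [Free₃.γ, Free₃.φ, freeToDual_ι, map_sub, map_mul, map_pow, map_ofNat, this, h4,
      pow_two, h1]
    noncomm_ring
  · have : coef hi 1 2 ^ 4 = coef hi 1 2 ^ 2 * coef hi 1 2 ^ 2 := by
      rw [← pow_add]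
    simp only [Free₃.γ, Free₃.φ, freeToDual_ι, map_sub, map_add, map_mul, map_pow, map_ofNat, this,
      h4, h2]
    noncomm_ring

theorem span_relators_le_ker :
    TwoSidedIdeal.span (Free₃.relators k) ≤ TwoSidedIdeal.ker (freeToDual hi) := by
  rw [TwoSidedIdeal.span_le]
  intro p hp
  exact TwoSidedIdeal.mem_ker _ |>.2 (freeToDual_relators hi hp)

/-- The kernel is generated by the relators, because every element is congruent to a normal form
and the normal forms are linearly independent as functionals. -/
theorem ker_freeToDual [CharZero k] :
    TwoSidedIdeal.ker (freeToDual hi) = TwoSidedIdeal.span (Free₃.relators k) := by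
  refine le_antisymm (fun p hp => ?_) (span_relators_le_ker hi)
  rw [TwoSidedIdeal.mem_ker] at hp
  set I := TwoSidedIdeal.span (Free₃.relators k) with hI
  let q : Free₃ k →ₐ[k] Free₃ k ⧸ I.asIdeal := Ideal.Quotient.mkₐ k I.asIdeal
  have hq : ∀ p, q p = 0 ↔ p ∈ I := fun p =>
    Ideal.Quotient.eq_zero_iff_mem.trans TwoSidedIdeal.mem_asIdeal
  have hrel : ∀ r ∈ Free₃.relators k, q r = 0 := fun r hr =>
    (hq r).2 (TwoSidedIdeal.subset_span hr)
  have hlift : FreeAlgebra.lift k ![q (Free₃.γ k), q (Free₃.φ k), q (Free₃.ψ k)] = q := by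
    apply FreeAlgebra.hom_ext
    funext j
    fin_cases j <;> simp [Free₃.γ, Free₃.φ, Free₃.ψ]
  have e1 := hrel (Free₃.ψ k ^ 2 - 1) (by simp [Free₃.relators])
  have e2 := hrel (Free₃.γ k * Free₃.ψ k + Free₃.ψ k * Free₃.γ k) (by simp [Free₃.relators])
  have e3 := hrel (Free₃.φ k * Free₃.ψ k + Free₃.ψ k * Free₃.φ k) (by simp [Free₃.relators])
  have e4 := hrel (27 * Free₃.γ k ^ 2 - Free₃.φ k ^ 6) (by simp [Free₃.relators])
  have e5 := hrel (3 * (Free₃.γ k * Free₃.φ k + Free₃.φ k * Free₃.γ k) - Free₃.φ k ^ 4)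
    (by simp [Free₃.relators])
  simp only [map_sub, map_add, map_mul, map_pow, map_one, map_ofNat, sub_eq_zero] at e1 e2 e3 e4 e5
  obtain ⟨u, hu⟩ := exists_normalForm e1 e2 e3 e4 e5 p
  rw [hlift, ← map_normalForm, ← sub_eq_zero, ← map_sub, hq] at hu
  have h1 := (TwoSidedIdeal.mem_ker _).1 (span_relators_le_ker hi hu)
  rw [map_sub, hp, zero_sub, neg_eq_zero, map_normalForm, Free₃.γ, Free₃.φ, Free₃.ψ, freeToDual_ι,
    freeToDual_ι, freeToDual_ι] at h1
  rw [normalForm_injective hi h1] at hu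
  simpa [normalForm, linComb] using hu

/-! ### The Hopf algebra `A_σ` -/

/-- The matrix coefficients of the span of `1, t², t³`, as elements of `A_σ`. -/
noncomputable def coefA : Matrix (Fin 3) (Fin 3) (A hi) := fun r s =>
  ⟨coef hi r s, subset_hopfClosure _ (coef_mem_matrixCoeffs hi r s)⟩

/-- The morphism `γ, φ, ψ ↦ a₁₃, a₂₃, a₃₃` to `A_σ`. -/
noncomputable def freeToA : Free₃ k →ₐ[k] A hi := FreeAlgebra.lift k fun j => coefA hi j 2

theorem freeToA_ι (j : Fin 3) : freeToA hi (FreeAlgebra.ι k j) = coefA hi j 2 :=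
  FreeAlgebra.lift_ι_apply _ _

theorem incl_coefA (r s : Fin 3) :
    ASigma.incl (isQuantumAut_sigma hi) (coefA hi r s) = coef hi r s := rfl

theorem incl_freeToA (p : Free₃ k) :
    ASigma.incl (isQuantumAut_sigma hi) (freeToA hi p) = freeToDual hi p := by
  have : (ASigma.incl (isQuantumAut_sigma hi)).comp (freeToA hi) = freeToDual hi := by
    apply FreeAlgebra.hom_ext
    funext j
    simp [freeToA_ι, freeToDual_ι, incl_coefA]
  exact AlgHom.congr_fun this p

theorem freeToA_surjective : Function.Surjective (freeToA hi) := by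
  intro a
  have := isHopfSubalgebra_range hi
  obtain ⟨p, hp⟩ := hopfClosure_le _ (matrixCoeffs_subset_range hi) a.2
  exact ⟨p, ASigma.incl_injective _ ((incl_freeToA hi p).trans hp)⟩

theorem ker_freeToA :
    TwoSidedIdeal.ker (freeToA hi) = TwoSidedIdeal.ker (freeToDual hi) := by
  ext p
  rw [TwoSidedIdeal.mem_ker, TwoSidedIdeal.mem_ker, ← incl_freeToA,
    map_eq_zero_iff _ (ASigma.incl_injective _)]

theorem coefA_one_one : coefA hi 1 1 = 1 := ASigma.incl_injective _ (coef_one_one hi)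

theorem coefA_zero_zero : coefA hi 0 0 = 1 := ASigma.incl_injective _ (coef_zero_zero hi)

theorem coefA_one_zero : coefA hi 1 0 = 0 := ASigma.incl_injective _ (coef_one_zero hi)

theorem coefA_two_zero : coefA hi 2 0 = 0 := ASigma.incl_injective _ (coef_two_zero hi)

theorem coefA_two_one : coefA hi 2 1 = 0 := ASigma.incl_injective _ (coef_two_one hi)

theorem coefA_zero_one : coefA hi 0 1 = (1 / 3 : k) • coefA hi 1 2 ^ 2 :=
  ASigma.incl_injective _ (by
    rw [map_smul, map_pow, incl_coefA, incl_coefA, coef_zero_one])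

theorem comul_coefA (r s : Fin 3) :
    comul (R := k) (coefA hi r s) = ∑ l, coefA hi r l ⊗ₜ[k] coefA hi l s := by
  apply TensorProduct.map_injective_of_flat_flat
    (ASigma.incl (isQuantumAut_sigma hi)).toLinearMap
    (ASigma.incl (isQuantumAut_sigma hi)).toLinearMap
    (ASigma.incl_injective _) (ASigma.incl_injective _) _
  rw [ASigma.map_incl_comul, incl_coefA, comul_coef, map_sum]
  rfl

theorem counit_coefA (r s : Fin 3) : counit (R := k) (coefA hi r s) = if r = s then 1 else 0 := by
  rw [← ASigma.counit_incl, incl_coefA, counit_coef]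

end Cusp
end QuantumCusp

theorem mainTheorem3 {k : Type*} [Field k] [NeZero (2 : k)] [NeZero (3 : k)]
    (i : k) (hi : i ^ 2 = -1) :
    ∃ a : Matrix (Fin 3) (Fin 3) (Cusp.A hi),
      -- `a r s` are the matrix coefficients of `F₃` in the basis `1, t², t³`
      (∀ (X : Cusp.H hi) (s : Fin 3), HSigma.act (Cusp.isQuantumAut_sigma hi) X (Cusp.e k s) =
        ∑ r, a r s X • Cusp.e k r) ∧
      ∃ π : Free₃ k →ₐ[k] Cusp.A hi,
        π (Free₃.γ k) = a 0 2 ∧ π (Free₃.φ k) = a 1 2 ∧ π (Free₃.ψ k) = a 2 2 ∧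
        -- presentation of `A_σ`
        Function.Surjective π ∧
        TwoSidedIdeal.span (Free₃.relators k) ≤ TwoSidedIdeal.ker π ∧
        (CharZero k → TwoSidedIdeal.ker π = TwoSidedIdeal.span (Free₃.relators k)) ∧
        -- coproduct
        comul (R := k) (π (Free₃.ψ k)) = π (Free₃.ψ k) ⊗ₜ[k] π (Free₃.ψ k) ∧
        comul (R := k) (π (Free₃.φ k)) =
          1 ⊗ₜ[k] π (Free₃.φ k) + π (Free₃.φ k) ⊗ₜ[k] π (Free₃.ψ k) ∧
        comul (R := k) (π (Free₃.γ k)) =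
          1 ⊗ₜ[k] π (Free₃.γ k) + ((1 / 3 : k) • π (Free₃.φ k) ^ 2) ⊗ₜ[k] π (Free₃.φ k) +
            π (Free₃.γ k) ⊗ₜ[k] π (Free₃.ψ k) ∧
        -- counit
        counit (R := k) (π (Free₃.ψ k)) = 1 ∧
        counit (R := k) (π (Free₃.γ k)) = 0 ∧
        counit (R := k) (π (Free₃.φ k)) = 0 ∧
        -- antipode
        antipode k (π (Free₃.ψ k)) = π (Free₃.ψ k) ∧
        antipode k (π (Free₃.φ k)) = -(π (Free₃.φ k) * π (Free₃.ψ k)) ∧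
        antipode k (π (Free₃.γ k)) =
          ((1 / 3 : k) • π (Free₃.φ k) ^ 3 - π (Free₃.γ k)) * π (Free₃.ψ k) := by
  have hγ : Cusp.freeToA hi (Free₃.γ k) = Cusp.coefA hi 0 2 := Cusp.freeToA_ι hi 0
  have hφ : Cusp.freeToA hi (Free₃.φ k) = Cusp.coefA hi 1 2 := Cusp.freeToA_ι hi 1
  have hψ : Cusp.freeToA hi (Free₃.ψ k) = Cusp.coefA hi 2 2 := Cusp.freeToA_ι hi 2
  refine ⟨Cusp.coefA hi, fun X s => Cusp.act_e hi X s, Cusp.freeToA hi, hγ, hφ, hψ,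
    Cusp.freeToA_surjective hi, ?_, fun _ => ?_, ?_⟩
  · rw [Cusp.ker_freeToA]
    exact Cusp.span_relators_le_ker hi
  · rw [Cusp.ker_freeToA]
    exact Cusp.ker_freeToDual hi
  rw [hγ, hφ, hψ]
  refine ⟨?_, ?_, ?_, Cusp.counit_coefA hi 2 2, Cusp.counit_coefA hi 0 2,
    Cusp.counit_coefA hi 1 2, ?_, ?_, ?_⟩
  · simp [Cusp.comul_coefA, Fin.sum_univ_three, Cusp.coefA_two_zero, Cusp.coefA_two_one]
  · simp [Cusp.comul_coefA, Fin.sum_univ_three, Cusp.coefA_one_zero, Cusp.coefA_one_one]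
  · simp [Cusp.comul_coefA, Fin.sum_univ_three, Cusp.coefA_zero_zero, Cusp.coefA_zero_one]
  · exact ASigma.incl_injective _ (Cusp.antipode_coef_two_two hi)
  · exact ASigma.incl_injective _ (Cusp.antipode_coef_one_two hi)
  · exact ASigma.incl_injective _ (Cusp.antipode_coef_zero_two hi)
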